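/- For $d\ge 1$, $\beta\in\mathbb R^d$ and a probability distribution $E$ on $\mathbb R$, let $P_{\beta,E}$ be the distribution of $(x,y)\in\mathbb R^d\times\mathbb R$ where $x\sim\mathcal N(0,I_d)$ and $y=x^\top\beta+Z$ with $Z\sim E$ independent of $x$. For $m\in\mathbb N$, $m\ge 1$, a $\mathrm{VSTAT}(m)$ oracle for a distribution $D$ answers a query, i.e. a measurable function $f$ with values in $[0,1]$, by some real $v$ with $$|v-\mathbb E_D[f]|\le\max\Bigl\{\tfrac1m,\sqrt{\tfrac{\mathbb E_D[f](1-\mathbb E_D[f])}{m}}\Bigr\}.$$ An SQ algorithm adaptively asks queries to such an oracle (each query may depend on the previous queries and answers) and then returns an output. **Theorem.** There are a polynomial $p$ with coefficients in $\mathbb N$, constants $C_1,C_2>0$ and $k\in\mathbb N$, all universal, and a deterministic SQ algorithm that takes $d\ge1$, $\alpha\in(0,1)$ and $\varepsilon\in(0,1)$ as input, such that for all such $d,\alpha,\varepsilon$ the following holds. The algorithm makes at most $p(d)$ queries, and for every $\beta^*\in\mathbb R^d$ with $\|\beta^*\|_2\le 1$ and every (unknown) distribution $E$ with $\mathbb P_{Z\sim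 E}(Z=0)\ge\alpha$, whenever each of its queries is given an arbitrary valid answer of a $\mathrm{VSTAT}(m)$ oracle for $P_{\beta^*,E}$, with $$m=\left\lceil \frac{C_1\, d\,\log^k(2d/\alpha)}{\varepsilon\alpha^2}\right\rceil ,$$ it outputs $\widehat\beta\in\mathbb R^d$ with $\|\widehat\beta-\beta^*\|_2\le C_2\,\varepsilon\alpha$. -/

import Mathlib

open MeasureTheory ProbabilityTheory

/-- The distribution `P_{β,E}` of noiseless linear regression with oblivious contamination in the
responses: `x ∼ N(0, I_d)`, `Z ∼ E` independent of `x`, and `y = ⟨x, β⟩ + Z`. -/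
noncomputable def obliviousRegression (d : ℕ) (β : EuclideanSpace ℝ (Fin d)) (E : Measure ℝ) :
    Measure (EuclideanSpace ℝ (Fin d) × ℝ) :=
  ((stdGaussian (EuclideanSpace ℝ (Fin d))).prod E).map
    (fun p => (p.1, inner ℝ p.1 β + p.2))

/-- A statistical query on `X`: a (measurable) function `X → [0, 1]`. -/
structure StatQuery (X : Type*) [MeasurableSpace X] where
  toFun : X → ℝ
  measurable_toFun : Measurable toFun
  mem_Icc : ∀ x, toFun x ∈ Set.Icc (0 : ℝ) 1

/-- The mean `𝔼_D[f]` of a statistical query. -/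
noncomputable def StatQuery.mean {X : Type*} [MeasurableSpace X] (f : StatQuery X)
    (D : Measure X) : ℝ :=
  ∫ x, f.toFun x ∂D

/-- `v` is a valid answer of a `VSTAT(m)` oracle for the distribution `D` to the query `f`. -/
def IsVSTATAnswer {X : Type*} [MeasurableSpace X] (D : Measure X) (m : ℕ) (f : StatQuery X)
    (v : ℝ) : Prop :=
  |v - f.mean D| ≤ max (1 / (m : ℝ)) (Real.sqrt (f.mean D * (1 - f.mean D) / m))

/-- A (deterministic, adaptive) statistical query algorithm on the domain `X` with outputs in `Θ`:
it either stops with an output, or asks a query and continues depending on the answer, so that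
every query may depend on all earlier queries and answers. -/
inductive SQAlgorithm (X Θ : Type*) [MeasurableSpace X] where
  | output (θ : Θ) : SQAlgorithm X Θ
  | query (f : StatQuery X) (next : ℝ → SQAlgorithm X Θ) : SQAlgorithm X Θ

namespace SQAlgorithm

/-- The algorithm makes at most `n` queries, whatever the answers are. -/
def QueriesAtMost {X Θ : Type*} [MeasurableSpace X] : SQAlgorithm X Θ → ℕ → Prop
  | output _, _ => True
  | query _ _, 0 => False
  | query _ next, n + 1 => ∀ v : ℝ, (next v).QueriesAtMost n

/-- When the algorithm is run with any `VSTAT(m)` oracle for `D` (each answer is an arbitrary valid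
one, however it is generated), its output satisfies `good`. -/
def Succeeds {X Θ : Type*} [MeasurableSpace X] (D : Measure X) (m : ℕ) (good : Θ → Prop) :
    SQAlgorithm X Θ → Prop
  | output θ => good θ
  | query f next => ∀ v : ℝ, IsVSTATAnswer D m f v → (next v).Succeeds D m good

end SQAlgorithm

/-! The estimate is refined in `4 * d + 12` rounds. If `‖b - β‖ ≤ δ`, the rescaled residual is `r =
⟨γ, x⟩ + z / δ` with `γ = (β - b) / δ` in the unit ball. For a Gaussian weight `W(x) = exp(-∑ w_j
x_j² / 2)`, Stein's identity gives `(1 + w_i) E[x_i W g(r)] = γ_i E[W g'(r)]`, whatever the noise.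
Hence each `γ_i` is a ratio of two means that can be queried, and the task is to bound the error of
that ratio. Put `Θ = α^(-1/(4d+12))`. A round must shrink the error by `√ε / Θ`; all rounds together
then give at most `ε α`.

With `q ≈ 1/√m`, a query of mean at most `M` is answered up to about `q² + √M q`. Two choices of `g`
are combined.

Global: `g = arctan`. The slope is at least a constant times the noise mass near `0` at scale `δ`,
so at least of order `α`. This gives error `q / α`, which is too large by a factor `Θ`, unless the
slope exceeds `Θ α` or `Θ` is bounded by a constant.

Local: otherwise the noise mass near `0` is `O(Θ α)`. A score localized at `|r| ≲ 1` then has mean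
`O(Θ α)`, and its answers have error about `√(Θ α) q`. Its slope is made steep at `0`, at scale `κ ≈
1/Θ`, so that the atom of the noise outweighs the negative slope of the cutoff. A weight of strength
`4/κ²` keeps `⟨γ, x⟩` at scale `κ`. It costs a factor of at most `(3/κ)^d ≤ Θ^(2d)`, and `Θ` is so
small a power of `1/α` that the gain `√(Θ α)` pays for it.

The main lemmas are `stein_gaussianWeight`, `le_integral_slopeQuery_localSlope`,
`abs_local_estimate_sub_le` and `abs_coordEstimate_sub_le`. -/

namespace SQAlgorithm

/-! ### Building SQ algorithms from rounds of non-adaptive queries -/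

variable {X Θ : Type*} [MeasurableSpace X]

/-- Ask finitely many queries non-adaptively, then continue. -/
def askFin : (n : ℕ) → (Fin n → StatQuery X) → ((Fin n → ℝ) → SQAlgorithm X Θ) → SQAlgorithm X Θ
  | 0, _, k => k Fin.elim0
  | n + 1, q, k =>
      query (q 0) (fun v => askFin n (fun i => q i.succ) (fun u => k (Fin.cons v u)))

theorem queriesAtMost_askFin (n : ℕ) (q : Fin n → StatQuery X)
    (k : (Fin n → ℝ) → SQAlgorithm X Θ) (N : ℕ) (hk : ∀ v, (k v).QueriesAtMost N) :
    (askFin n q k).QueriesAtMost (n + N) := by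
  induction n with
  | zero => simpa [askFin] using hk _
  | succ n ih =>
    rw [show n + 1 + N = (n + N) + 1 by ring, askFin, QueriesAtMost]
    exact fun v => ih _ _ fun u => hk _

theorem succeeds_askFin (D : Measure X) (m : ℕ) (good : Θ → Prop) (n : ℕ)
    (q : Fin n → StatQuery X) (k : (Fin n → ℝ) → SQAlgorithm X Θ)
    (hk : ∀ v, (∀ i, IsVSTATAnswer D m (q i) (v i)) → (k v).Succeeds D m good) :
    (askFin n q k).Succeeds D m good := by
  induction n with
  | zero => simpa [askFin] using hk _ (fun i => i.elim0)
  | succ n ih =>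
    rw [askFin, Succeeds]
    refine fun v hv => ih _ _ fun u hu => hk _ fun i => ?_
    refine Fin.cases ?_ (fun i => ?_) i
    · simpa using hv
    · simpa using hu i

/-- Ask a finite family of queries non-adaptively, then continue. -/
noncomputable def ask {ι : Type*} [Fintype ι] (q : ι → StatQuery X)
    (k : (ι → ℝ) → SQAlgorithm X Θ) : SQAlgorithm X Θ :=
  askFin (Fintype.card ι) (fun i => q ((Fintype.equivFin ι).symm i))
    (fun v => k (fun i => v (Fintype.equivFin ι i)))

theorem queriesAtMost_ask {ι : Type*} [Fintype ι] (q : ι → StatQuery X)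
    (k : (ι → ℝ) → SQAlgorithm X Θ) (N : ℕ) (hk : ∀ v, (k v).QueriesAtMost N) :
    (ask q k).QueriesAtMost (Fintype.card ι + N) :=
  queriesAtMost_askFin _ _ _ _ fun _ => hk _

theorem succeeds_ask (D : Measure X) (m : ℕ) (good : Θ → Prop) {ι : Type*} [Fintype ι]
    (q : ι → StatQuery X) (k : (ι → ℝ) → SQAlgorithm X Θ)
    (hk : ∀ v, (∀ i, IsVSTATAnswer D m (q i) (v i)) → (k v).Succeeds D m good) :
    (ask q k).Succeeds D m good := by
  refine succeeds_askFin _ _ _ _ _ _ fun v hv => hk _ fun i => ?_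
  simpa using hv (Fintype.equivFin ι i)

/-- Run `T` rounds of non-adaptive queries, where the queries of a round depend on the current
state and on the number of rounds that have been completed. -/
noncomputable def rounds {ι : Type*} [Fintype ι] (q : ℕ → Θ → ι → StatQuery X)
    (upd : ℕ → Θ → (ι → ℝ) → Θ) : (T t : ℕ) → Θ → SQAlgorithm X Θ
  | 0, _, θ => output θ
  | T + 1, t, θ => ask (q t θ) (fun v => rounds q upd T (t + 1) (upd t θ v))

theorem queriesAtMost_rounds {ι : Type*} [Fintype ι] (q : ℕ → Θ → ι → StatQuery X)
    (upd : ℕ → Θ → (ι → ℝ) → Θ) (T t : ℕ) (θ : Θ) :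
    (rounds q upd T t θ).QueriesAtMost (Fintype.card ι * T) := by
  induction T generalizing t θ with
  | zero => simp [rounds, QueriesAtMost]
  | succ T ih =>
    rw [rounds, show Fintype.card ι * (T + 1) = Fintype.card ι + Fintype.card ι * T by ring]
    exact queriesAtMost_ask _ _ _ fun v => ih _ _

theorem succeeds_rounds (D : Measure X) (m : ℕ) {ι : Type*} [Fintype ι]
    (q : ℕ → Θ → ι → StatQuery X) (upd : ℕ → Θ → (ι → ℝ) → Θ) (Inv : ℕ → Θ → Prop)
    (hstep : ∀ t θ v, Inv t θ → (∀ i, IsVSTATAnswer D m (q t θ i) (v i)) →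
      Inv (t + 1) (upd t θ v))
    (T t : ℕ) (θ : Θ) (h0 : Inv t θ) :
    (rounds q upd T t θ).Succeeds D m (Inv (t + T)) := by
  induction T generalizing t θ with
  | zero => simpa [rounds, Succeeds] using h0
  | succ T ih =>
    rw [rounds]
    refine succeeds_ask _ _ _ _ _ fun v hv => ?_
    have := ih (t + 1) (upd t θ v) (hstep t θ v h0 hv)
    rwa [show t + 1 + T = t + (T + 1) by ring] at this

theorem Succeeds.mono {D : Measure X} {m : ℕ} {good good' : Θ → Prop}
    (h : ∀ θ, good θ → good' θ) {A : SQAlgorithm X Θ} (hA : A.Succeeds D m good) :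
    A.Succeeds D m good' := by
  induction A with
  | output θ => exact h θ hA
  | query f next ih => exact fun v hv => ih v (hA v hv)

end SQAlgorithm

/-! ### Means of signed functions from VSTAT answers -/

/-- The function `F`, clipped to `[0, 1]`, as a statistical query. -/
noncomputable def StatQuery.clip {X : Type*} [MeasurableSpace X] (F : X → ℝ)
    (hF : Measurable F) : StatQuery X where
  toFun x := max (min (F x) 1) 0
  measurable_toFun := (hF.min measurable_const).max measurable_const
  mem_Icc _ := ⟨le_max_right _ _, max_le (min_le_right _ _) zero_le_one⟩

/-- The variance of a `[0, 1]`-valued query is at most its mean, so queries of small mean get more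
precise answers; the local queries exploit this. -/
theorem IsVSTATAnswer.abs_sub_le {X : Type*} [MeasurableSpace X] {D : Measure X}
    [IsProbabilityMeasure D] {m : ℕ} {f : StatQuery X} {v M : ℝ} (h : IsVSTATAnswer D m f v)
    (hM : f.mean D ≤ M) : |v - f.mean D| ≤ 1 / m + √(M / m) := by
  have h0 : 0 ≤ f.mean D := integral_nonneg fun x => (f.mem_Icc x).1
  refine le_trans h (max_le ?_ ?_)
  · linarith [Real.sqrt_nonneg (M / m)]
  · have : f.mean D * (1 - f.mean D) ≤ M := by nlinarith
    have h1 : √(f.mean D * (1 - f.mean D) / m) ≤ √(M / m) :=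
      Real.sqrt_le_sqrt (div_le_div_of_nonneg_right this (Nat.cast_nonneg m))
    have : (0 : ℝ) ≤ 1 / m := by positivity
    linarith

/-- Valid answers to the clipped versions of `F` and `-F` give the mean of `F` if `|F| ≤ 1`. -/
theorem abs_sub_integral_le_of_answers {X : Type*} [MeasurableSpace X] {D : Measure X}
    [IsProbabilityMeasure D] {m : ℕ} {F : X → ℝ} {hF : Measurable F}
    {hF' : Measurable (fun x => -F x)} (hb : ∀ x, |F x| ≤ 1)
    {v v' M : ℝ} (hv : IsVSTATAnswer D m (StatQuery.clip F hF) v)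
    (hv' : IsVSTATAnswer D m (StatQuery.clip (fun x => -F x) hF') v')
    (hM : ∫ x, |F x| ∂D ≤ M) : |v - v' - ∫ x, F x ∂D| ≤ 2 * (1 / m + √(M / m)) := by
  have hi : Integrable F D := Integrable.of_bound hF.aestronglyMeasurable 1 (ae_of_all _ hb)
  have e1 : (StatQuery.clip F hF).mean D = ∫ x, max (F x) 0 ∂D :=
    integral_congr_ae (ae_of_all _ fun x => by
      simp only [StatQuery.clip, min_eq_left ((le_abs_self _).trans (hb x))])
  have e2 : (StatQuery.clip (fun x => -F x) hF').mean D = ∫ x, max (-F x) 0 ∂D :=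
    integral_congr_ae (ae_of_all _ fun x => by
      simp only [StatQuery.clip, min_eq_left ((neg_le_abs _).trans (hb x))])
  have i1 : Integrable (fun x => max (F x) 0) D := hi.pos_part
  have i2 : Integrable (fun x => max (-F x) 0) D := hi.neg_part
  have h1 := hv.abs_sub_le (M := M) (by
    rw [e1]
    exact (integral_mono i1 hi.abs fun x => max_le (le_abs_self _) (abs_nonneg _)).trans hM)
  have h2 := hv'.abs_sub_le (M := M) (by
    rw [e2]
    exact (integral_mono i2 hi.abs fun x => max_le (neg_le_abs _) (abs_nonneg _)).trans hM)
  have e3 : ∫ x, F x ∂D = ∫ x, max (F x) 0 ∂D - ∫ x, max (-F x) 0 ∂D := by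
    rw [← integral_sub i1 i2]
    refine integral_congr_ae (ae_of_all _ fun x => ?_)
    rcases le_total (F x) 0 with h | h
    · simp [max_eq_right h, max_eq_left (neg_nonneg.2 h)]
    · simp [max_eq_left h, max_eq_right (neg_nonpos.2 h)]
  rw [e1] at h1; rw [e2] at h2; rw [e3]
  rw [abs_le] at *
  constructor <;> linarith

/-! ### Gaussian weights and Stein's identity -/

/-- Integration by parts against a centred Gaussian density. -/
theorem integral_mul_exp_mul_comp_eq (c a b A : ℝ) (hc : 0 < c) (g dg : ℝ → ℝ)
    (hg : ∀ u, HasDerivAt g (dg u) u) (hdg : Continuous dg) (hlin : ∀ u, |g u| ≤ A * (1 + |u|))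
    (hbd : ∀ u, |dg u| ≤ A) :
    c * ∫ t : ℝ, t * (Real.exp (-(c * t ^ 2 / 2)) * g (a * t + b)) =
      a * ∫ t : ℝ, Real.exp (-(c * t ^ 2 / 2)) * dg (a * t + b) := by
  have hA : 0 ≤ A := (abs_nonneg _).trans (hbd 0)
  have hgc : Continuous g := continuous_iff_continuousAt.2 fun u => (hg u).continuousAt
  have hI0 : Integrable fun t : ℝ => Real.exp (-(c * t ^ 2 / 2)) := by
    have := integrable_exp_neg_mul_sq (half_pos hc)
    refine this.congr (ae_of_all _ fun t => ?_)
    simp only; congr 1; ring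
  have hI2 : Integrable fun t : ℝ => t ^ 2 * Real.exp (-(c * t ^ 2 / 2)) := by
    have := integrable_rpow_mul_exp_neg_mul_sq (half_pos hc) (s := 2) (by norm_num)
    refine this.congr (ae_of_all _ fun t => ?_)
    simp only [Real.rpow_two]; congr 2; ring
  -- One dominating function, a multiple of `(1 + t²) exp(-c t² / 2)`, serves the integrands with
  -- and without the factor `t`.
  have hdom : Integrable fun t : ℝ =>
      (A * (2 + |a| + |b|)) * (Real.exp (-(c * t ^ 2 / 2)) + t ^ 2 * Real.exp (-(c * t ^ 2 / 2))) :=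
    (hI0.add hI2).const_mul _
  have hlin' : ∀ t, |g (a * t + b)| ≤ A * (1 + |b| + |a| * |t|) := fun t => by
    refine (hlin _).trans (mul_le_mul_of_nonneg_left ?_ hA)
    have := abs_add_le (a * t) b
    rw [abs_mul] at this
    linarith
  have hsq : ∀ t : ℝ, |t| ≤ 1 + t ^ 2 := fun t => by
    rw [← sq_abs]; nlinarith [sq_nonneg (|t| - 1), abs_nonneg t]
  have hsq2 : ∀ t : ℝ, |t| * |t| = t ^ 2 := fun t => by rw [← sq_abs]; ring
  have hp : ∀ t : ℝ, 0 ≤ Real.exp (-(c * t ^ 2 / 2)) := fun t => (Real.exp_pos _).le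
  have iuv : Integrable fun t : ℝ => Real.exp (-(c * t ^ 2 / 2)) * g (a * t + b) := by
    refine hdom.mono' (by fun_prop) (ae_of_all _ fun t => ?_)
    rw [Real.norm_eq_abs, abs_mul, abs_of_nonneg (hp t)]
    have h2 : A * (1 + |b| + |a| * |t|) ≤ A * (2 + |a| + |b|) * (1 + t ^ 2) := by
      rw [mul_assoc]
      refine mul_le_mul_of_nonneg_left ?_ hA
      nlinarith [mul_le_mul_of_nonneg_left (hsq t) (abs_nonneg a), abs_nonneg b, sq_nonneg t,
        mul_nonneg (abs_nonneg b) (sq_nonneg t)]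
    nlinarith [mul_le_mul_of_nonneg_left ((hlin' t).trans h2) (hp t)]
  have ituv : Integrable fun t : ℝ => t * (Real.exp (-(c * t ^ 2 / 2)) * g (a * t + b)) := by
    refine hdom.mono' (by fun_prop) (ae_of_all _ fun t => ?_)
    rw [Real.norm_eq_abs, abs_mul, abs_mul, abs_of_nonneg (hp t)]
    have h2 : |t| * (A * (1 + |b| + |a| * |t|)) ≤ A * (2 + |a| + |b|) * (1 + t ^ 2) := by
      rw [mul_assoc, mul_left_comm]
      refine mul_le_mul_of_nonneg_left ?_ hA
      rw [show |t| * (1 + |b| + |a| * |t|) = |t| * (1 + |b|) + |a| * (|t| * |t|) by ring, hsq2]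
      nlinarith [mul_le_mul_of_nonneg_right (hsq t) (by positivity : 0 ≤ 1 + |b|), abs_nonneg a,
        sq_nonneg t]
    have h3 := mul_le_mul_of_nonneg_left (hlin' t) (abs_nonneg t)
    nlinarith [mul_le_mul_of_nonneg_left (h3.trans h2) (hp t)]
  have iudv : Integrable fun t : ℝ => Real.exp (-(c * t ^ 2 / 2)) * (a * dg (a * t + b)) := by
    refine (hI0.mul_const (|a| * A)).mono' (by fun_prop) (ae_of_all _ fun t => ?_)
    rw [Real.norm_eq_abs, abs_mul, abs_of_nonneg (hp t), abs_mul]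
    gcongr
    exact hbd _
  have key := integral_mul_deriv_eq_deriv_mul_of_integrable
    (u := fun t => Real.exp (-(c * t ^ 2 / 2))) (v := fun t => g (a * t + b))
    (u' := fun t => -(c * (t * Real.exp (-(c * t ^ 2 / 2))))) (v' := fun t => a * dg (a * t + b))
    (fun t _ => by
      have h1 : HasDerivAt (fun t : ℝ => -(c * t ^ 2 / 2)) (-(c * t)) t := by
        have := (((hasDerivAt_id t).pow 2).const_mul c).div_const 2
        refine (this.neg).congr_deriv ?_
        simp; ring
      refine h1.exp.congr_deriv ?_
      ring)
    (fun t _ => by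
      have h1 : HasDerivAt (fun t : ℝ => a * t + b) a t := by
        simpa using ((hasDerivAt_id t).const_mul a).add_const b
      refine ((hg (a * t + b)).comp t h1).congr_deriv ?_
      ring)
    iudv
    (by
      refine (ituv.const_mul (-c)).congr (ae_of_all _ fun t => ?_)
      simp only [Pi.mul_apply]; ring)
    iuv
  rw [← integral_const_mul, ← integral_const_mul]
  have e1 : ∫ t : ℝ, a * (Real.exp (-(c * t ^ 2 / 2)) * dg (a * t + b)) =
      ∫ t : ℝ, Real.exp (-(c * t ^ 2 / 2)) * (a * dg (a * t + b)) := by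
    congr 1; ext t; ring
  rw [e1, key, ← integral_neg]
  congr 1; ext t; ring

/-- The standard Gaussian measure on `Fin d → ℝ`. -/
noncomputable abbrev gaussianPi (d : ℕ) : Measure (Fin d → ℝ) :=
  Measure.pi fun _ => gaussianReal 0 1

/-- A Gaussian weight. -/
noncomputable def gaussianWeight {d : ℕ} (w x : Fin d → ℝ) : ℝ :=
  Real.exp (-(∑ j, w j * x j ^ 2 / 2))

@[fun_prop]
theorem continuous_gaussianWeight {d : ℕ} (w : Fin d → ℝ) : Continuous (gaussianWeight w) := by
  unfold gaussianWeight; fun_prop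

theorem gaussianWeight_pos {d : ℕ} (w x : Fin d → ℝ) : 0 < gaussianWeight w x := Real.exp_pos _

theorem gaussianWeight_le_one {d : ℕ} {w : Fin d → ℝ} (hw : ∀ j, 0 ≤ w j) (x : Fin d → ℝ) :
    gaussianWeight w x ≤ 1 := by
  rw [gaussianWeight, Real.exp_le_one_iff, neg_nonpos]
  exact Finset.sum_nonneg fun j _ => by have := hw j; positivity

theorem integral_gaussianReal_mul_exp (w : ℝ) (f : ℝ → ℝ) :
    ∫ t, Real.exp (-(w * t ^ 2 / 2)) * f t ∂gaussianReal 0 1 =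
      (√(2 * Real.pi))⁻¹ * ∫ t, Real.exp (-((1 + w) * t ^ 2 / 2)) * f t := by
  rw [integral_gaussianReal_eq_integral_smul one_ne_zero, ← integral_const_mul]
  congr 1; ext t
  simp only [gaussianPDFReal, smul_eq_mul, NNReal.coe_one, mul_one, sub_zero]
  rw [show -((1 + w) * t ^ 2 / 2) = -t ^ 2 / 2 + -(w * t ^ 2 / 2) by ring, Real.exp_add]
  ring

theorem integral_gaussianWeight {d : ℕ} (w : Fin d → ℝ) (hw : ∀ j, 0 ≤ w j) :
    ∫ x, gaussianWeight w x ∂gaussianPi d = ∏ j, (√(1 + w j))⁻¹ := by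
  have h : ∀ x, gaussianWeight w x = ∏ j, Real.exp (-(w j * x j ^ 2 / 2)) := fun x => by
    rw [gaussianWeight, ← Finset.sum_neg_distrib, Real.exp_sum]
  simp_rw [h]
  rw [integral_fintype_prod_eq_prod (f := fun j t => Real.exp (-(w j * t ^ 2 / 2)))]
  refine Finset.prod_congr rfl fun j _ => ?_
  have h1 := integral_gaussianReal_mul_exp (w j) (fun _ => 1)
  simp only [mul_one] at h1
  have h2 := integral_gaussian ((1 + w j) / 2)
  have h3 : ∫ t : ℝ, Real.exp (-((1 + w j) * t ^ 2 / 2)) = √(Real.pi / ((1 + w j) / 2)) := by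
    rw [← h2]; congr 1; ext t; congr 1; ring
  have hpos : 0 < 1 + w j := by linarith [hw j]
  rw [h1, h3, show Real.pi / ((1 + w j) / 2) = (2 * Real.pi) / (1 + w j) by field_simp,
    Real.sqrt_div (by positivity)]
  have : √(2 * Real.pi) ≠ 0 := by positivity
  field_simp

theorem integrable_eval_mul_eval {d : ℕ} (i j : Fin d) :
    Integrable (fun x => x i * x j) (gaussianPi d) := by
  have h : ∀ i : Fin d, MemLp (fun x : Fin d → ℝ => x i) 2 (gaussianPi d) := fun i =>
    (memLp_id_gaussianReal 2).comp_measurePreserving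
      (measurePreserving_eval (fun _ : Fin d => gaussianReal 0 1) i)
  exact (h i).integrable_mul (h j)

theorem integrable_eval_gaussianPi {d : ℕ} (i : Fin d) :
    Integrable (fun x => x i) (gaussianPi d) := by
  have h : MemLp (fun x : Fin d → ℝ => x i) 2 (gaussianPi d) :=
    (memLp_id_gaussianReal 2).comp_measurePreserving
      (measurePreserving_eval (fun _ : Fin d => gaussianReal 0 1) i)
  exact h.integrable (by norm_num)

theorem integrable_eval_mul_weight_mul_comp {d : ℕ} (w : Fin d → ℝ) (hw : ∀ j, 0 ≤ w j)
    (γ : Fin d → ℝ) (z A : ℝ) (g : ℝ → ℝ) (hg : Continuous g)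
    (hlin : ∀ u, |g u| ≤ A * (1 + |u|)) (i : Fin d) :
    Integrable (fun x => x i * (gaussianWeight w x * g (∑ j, γ j * x j + z))) (gaussianPi d) := by
  have hA : 0 ≤ A := by simpa using (abs_nonneg _).trans (hlin 0)
  have hdom : Integrable (fun x : Fin d → ℝ =>
      A * ((1 + |z|) * |x i| + ∑ j, |γ j| * |x i * x j|)) (gaussianPi d) :=
    (((integrable_eval_gaussianPi i).abs.const_mul _).add
      (integrable_finsetSum _ fun j _ => (integrable_eval_mul_eval i j).abs.const_mul _)).const_mul _
  refine hdom.mono' (by fun_prop) (ae_of_all _ fun x => ?_)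
  rw [Real.norm_eq_abs, abs_mul, abs_mul, abs_of_pos (gaussianWeight_pos w x)]
  have h1 : |g (∑ j, γ j * x j + z)| ≤ A * (1 + |z| + ∑ j, |γ j| * |x j|) := by
    refine (hlin _).trans (mul_le_mul_of_nonneg_left ?_ hA)
    have h2 := abs_add_le (∑ j, γ j * x j) z
    have h3 := Finset.abs_sum_le_sum_abs (fun j => γ j * x j) Finset.univ
    simp_rw [abs_mul] at h3
    linarith
  calc |x i| * (gaussianWeight w x * |g (∑ j, γ j * x j + z)|)
      ≤ |x i| * (1 * (A * (1 + |z| + ∑ j, |γ j| * |x j|))) := by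
        gcongr
        exact gaussianWeight_le_one hw x
    _ = A * ((1 + |z|) * |x i| + ∑ j, |γ j| * |x i * x j|) := by
        simp_rw [abs_mul]
        have : ∑ j, |γ j| * (|x i| * |x j|) = |x i| * ∑ j, |γ j| * |x j| := by
          rw [Finset.mul_sum]; exact Finset.sum_congr rfl fun j _ => by ring
        rw [this]; ring

/-- Stein's identity for Gaussian weights. -/
theorem stein_gaussianWeight {d : ℕ} (w : Fin d → ℝ) (hw : ∀ j, 0 ≤ w j)
    (γ : Fin d → ℝ) (z A : ℝ) (g dg : ℝ → ℝ) (hg : ∀ u, HasDerivAt g (dg u) u)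
    (hdg : Continuous dg) (hlin : ∀ u, |g u| ≤ A * (1 + |u|)) (hbd : ∀ u, |dg u| ≤ A)
    (i : Fin d) :
    (1 + w i) * ∫ x, x i * (gaussianWeight w x * g (∑ j, γ j * x j + z)) ∂gaussianPi d =
      γ i * ∫ x, gaussianWeight w x * dg (∑ j, γ j * x j + z) ∂gaussianPi d := by
  have hgc : Continuous g := continuous_iff_continuousAt.2 fun u => (hg u).continuousAt
  have I1 := integrable_eval_mul_weight_mul_comp w hw γ z A g hgc hlin i
  have I2 : Integrable (fun x => gaussianWeight w x * dg (∑ j, γ j * x j + z)) (gaussianPi d) := by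
    refine Integrable.of_bound (by fun_prop) A (ae_of_all _ fun x => ?_)
    rw [Real.norm_eq_abs, abs_mul, abs_of_pos (gaussianWeight_pos w x)]
    calc _ ≤ 1 * A := by
          gcongr
          · exact gaussianWeight_le_one hw x
          · exact hbd _
      _ = A := one_mul A
  obtain _ | n := d
  · exact i.elim0
  -- Fubini singles out coordinate `i`; the weight factorizes, and its `i`-th factor turns the
  -- density into a Gaussian of precision `1 + w i`.
  have hmp := (measurePreserving_piFinSuccAbove (fun _ : Fin (n + 1) => gaussianReal 0 1) i).symm
  have hfub : ∀ F : (Fin (n + 1) → ℝ) → ℝ, Integrable F (gaussianPi (n + 1)) →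
      ∫ x, F x ∂gaussianPi (n + 1) =
        ∫ y : Fin n → ℝ, ∫ t, F (i.insertNth t y) ∂gaussianReal 0 1 ∂gaussianPi n := by
    intro F hF
    rw [← hmp.integral_comp']
    rw [integral_prod_symm]
    · rfl
    · exact (hmp.integrable_comp_emb (MeasurableEquiv.measurableEmbedding _)).2 hF
  rw [hfub _ I1, hfub _ I2, ← integral_const_mul, ← integral_const_mul]
  congr 1; ext y
  have hw' : ∀ t, gaussianWeight w (i.insertNth t y : Fin (n + 1) → ℝ) =
      Real.exp (-(∑ j, w (i.succAbove j) * y j ^ 2 / 2)) * Real.exp (-(w i * t ^ 2 / 2)) := by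
    intro t
    rw [gaussianWeight, Fin.sum_univ_succAbove _ i, ← Real.exp_add]
    congr 1
    simp only [Fin.insertNth_apply_same, Fin.insertNth_apply_succAbove]
    ring
  have hs : ∀ t, ∑ j, γ j * (i.insertNth t y : Fin (n + 1) → ℝ) j + z =
      γ i * t + (∑ j, γ (i.succAbove j) * y j + z) := by
    intro t
    rw [Fin.sum_univ_succAbove _ i]
    simp only [Fin.insertNth_apply_same, Fin.insertNth_apply_succAbove]
    ring
  set b := ∑ j, γ (i.succAbove j) * y j + z
  set K := Real.exp (-(∑ j, w (i.succAbove j) * y j ^ 2 / 2))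
  simp_rw [hw', hs, Fin.insertNth_apply_same]
  have e1 : ∀ t, t * (K * Real.exp (-(w i * t ^ 2 / 2)) * g (γ i * t + b)) =
      K * (Real.exp (-(w i * t ^ 2 / 2)) * (t * g (γ i * t + b))) := fun t => by ring
  have e2 : ∀ t, K * Real.exp (-(w i * t ^ 2 / 2)) * dg (γ i * t + b) =
      K * (Real.exp (-(w i * t ^ 2 / 2)) * dg (γ i * t + b)) := fun t => by ring
  simp_rw [e1, e2, integral_const_mul]
  rw [integral_gaussianReal_mul_exp, integral_gaussianReal_mul_exp]
  have key := integral_mul_exp_mul_comp_eq (1 + w i) (γ i) b A (by linarith [hw i]) g dg hg hdg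
    hlin hbd
  have e3 : ∀ t, Real.exp (-((1 + w i) * t ^ 2 / 2)) * (t * g (γ i * t + b)) =
      t * (Real.exp (-((1 + w i) * t ^ 2 / 2)) * g (γ i * t + b)) := fun t => by ring
  simp_rw [e3]
  calc _ = K * ((√(2 * Real.pi))⁻¹ *
        ((1 + w i) * ∫ t, t * (Real.exp (-((1 + w i) * t ^ 2 / 2)) * g (γ i * t + b)))) := by ring
    _ = _ := by rw [key]; ring

theorem sum_mul_mul_eq_mul_sq {d : ℕ} (γ x : Fin d → ℝ) (c : ℝ) :
    ∑ i, γ i * (x i * (c * ∑ j, γ j * x j)) = c * (∑ j, γ j * x j) ^ 2 := by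
  have : ∀ i, γ i * (x i * (c * ∑ j, γ j * x j)) = (γ i * x i) * (c * ∑ j, γ j * x j) :=
    fun i => by ring
  simp_rw [this]
  rw [← Finset.sum_mul]
  ring

theorem integrable_weight_mul_sq {d : ℕ} (w : Fin d → ℝ) (hw : ∀ j, 0 ≤ w j) (γ : Fin d → ℝ) :
    Integrable (fun x => gaussianWeight w x * (∑ j, γ j * x j) ^ 2) (gaussianPi d) := by
  have h := fun i => (integrable_eval_mul_weight_mul_comp w hw γ 0 1 id continuous_id
    (fun u => by simp) i).const_mul (γ i)
  refine (integrable_finsetSum Finset.univ fun i _ => h i).congr (ae_of_all _ fun x => ?_)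
  simp only [id, add_zero]
  exact sum_mul_mul_eq_mul_sq _ _ _

/-- Second moments of linear forms under a Gaussian weight. -/
theorem integral_weight_mul_sq_le {d : ℕ} (w : Fin d → ℝ) (a : ℝ) (ha : 0 ≤ a) (hw : ∀ j, a ≤ w j)
    (γ : Fin d → ℝ) :
    (1 + a) * ∫ x, gaussianWeight w x * (∑ j, γ j * x j) ^ 2 ∂gaussianPi d ≤
      (∑ j, γ j ^ 2) * ∫ x, gaussianWeight w x ∂gaussianPi d := by
  have hw0 : ∀ j, 0 ≤ w j := fun j => ha.trans (hw j)
  have hI := fun i => integrable_eval_mul_weight_mul_comp w hw0 γ 0 1 id continuous_id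
    (fun u => by simp) i
  have hst := fun i => stein_gaussianWeight w hw0 γ 0 1 id (fun _ => 1)
    (fun u => hasDerivAt_id u) continuous_const (fun u => by simp) (fun u => by simp) i
  simp only [id, add_zero, mul_one] at hI hst
  -- One factor of the square is expanded, so that Stein's identity with `g = id` applies to each
  -- term.
  have e : ∫ x, gaussianWeight w x * (∑ j, γ j * x j) ^ 2 ∂gaussianPi d =
      ∑ i, γ i * ∫ x, x i * (gaussianWeight w x * (∑ j, γ j * x j)) ∂gaussianPi d := by
    simp_rw [← integral_const_mul]
    rw [← integral_finsetSum _ fun i _ => (hI i).const_mul (γ i)]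
    congr 1; ext x
    exact (sum_mul_mul_eq_mul_sq _ _ _).symm
  rw [e, Finset.mul_sum, Finset.sum_mul]
  refine Finset.sum_le_sum fun i _ => ?_
  have hpos : 0 < 1 + w i := by linarith [hw0 i]
  have hW : 0 ≤ ∫ x, gaussianWeight w x ∂gaussianPi d :=
    integral_nonneg fun x => (gaussianWeight_pos w x).le
  have : γ i * ∫ x, x i * (gaussianWeight w x * (∑ j, γ j * x j)) ∂gaussianPi d =
      γ i ^ 2 * (∫ x, gaussianWeight w x ∂gaussianPi d) / (1 + w i) := by
    rw [eq_div_iff hpos.ne']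
    calc _ = γ i * ((1 + w i) * ∫ x, x i * (gaussianWeight w x * (∑ j, γ j * x j))
            ∂gaussianPi d) := by ring
      _ = _ := by rw [hst]; ring
  rw [this, mul_div_assoc', div_le_iff₀ hpos, mul_comm]
  exact mul_le_mul_of_nonneg_left (by linarith [hw i]) (by positivity)

/-! ### The Cauchy bump and the localized score -/

/-- The bump `u ↦ 1 / (1 + u ^ 2)`. -/
noncomputable def cauchyBump (u : ℝ) : ℝ := (1 + u ^ 2)⁻¹

theorem cauchyBump_pos (u : ℝ) : 0 < cauchyBump u := by unfold cauchyBump; positivity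

theorem cauchyBump_le_one (u : ℝ) : cauchyBump u ≤ 1 :=
  inv_le_one_of_one_le₀ (by nlinarith [sq_nonneg u])

@[fun_prop]
theorem continuous_cauchyBump : Continuous cauchyBump :=
  Continuous.inv₀ (by fun_prop) fun u => by positivity

theorem abs_cauchyBump_le_one (u : ℝ) : |cauchyBump u| ≤ 1 := by
  rw [abs_of_pos (cauchyBump_pos u)]; exact cauchyBump_le_one u

/-- With `cauchyBump_add_le`: polynomial tails make the bump stable under shifts up to factors
depending only on the shift, so averaging over `⟨γ, x⟩` changes the noise mass by constants only. -/
theorem cauchyBump_mul_le (t z : ℝ) : cauchyBump t * cauchyBump z / 2 ≤ cauchyBump (t + z) := by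
  unfold cauchyBump
  rw [← mul_inv, div_eq_mul_inv, ← mul_inv]
  exact inv_anti₀ (by positivity) (by nlinarith [sq_nonneg (t - z), sq_nonneg (t * z)])

theorem cauchyBump_add_le (t z : ℝ) : cauchyBump (t + z) ≤ 2 * (1 + t ^ 2) * cauchyBump z := by
  unfold cauchyBump
  rw [← div_eq_mul_inv, le_div_iff₀ (by positivity), inv_mul_le_iff₀ (by positivity)]
  nlinarith [sq_nonneg (2 * t + z), sq_nonneg (t * (t + z)), sq_nonneg t]

/-- Tangent line of the convex function `s ↦ 1 / (1 + s)` at `s = 1`, taken at `s = t²`. -/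
theorem le_cauchyBump (t : ℝ) : 3 / 4 - t ^ 2 / 4 ≤ cauchyBump t := by
  unfold cauchyBump
  rw [← one_div, le_div_iff₀ (by positivity)]
  nlinarith [sq_nonneg (t ^ 2 - 1)]

theorem one_sub_le_cauchyBump (t : ℝ) : 1 - t ^ 2 ≤ cauchyBump t := by
  unfold cauchyBump
  rw [← one_div, le_div_iff₀ (by positivity)]
  nlinarith [sq_nonneg (t ^ 2)]

theorem abs_arctan_le_two (u : ℝ) : |Real.arctan u| ≤ 2 := by
  have h1 := Real.arctan_lt_pi_div_two u
  have h2 := Real.neg_pi_div_two_lt_arctan u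
  have h3 := Real.pi_le_four
  rw [abs_le]; constructor <;> linarith

theorem hasDerivAt_arctan_cauchyBump (u : ℝ) : HasDerivAt Real.arctan (cauchyBump u) u := by
  simpa [cauchyBump] using Real.hasDerivAt_arctan u

/-- A localized score function with a steep slope at the origin. -/
noncomputable def localScore (κ u : ℝ) : ℝ := Real.arctan (u / κ) * cauchyBump u

/-- The derivative of `localScore κ`. -/
noncomputable def localSlope (κ u : ℝ) : ℝ :=
  κ⁻¹ * (cauchyBump (u / κ) * cauchyBump u) - Real.arctan (u / κ) * (2 * u * cauchyBump u ^ 2)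

@[fun_prop]
theorem continuous_localScore (κ : ℝ) : Continuous (localScore κ) := by
  unfold localScore; fun_prop

@[fun_prop]
theorem continuous_localSlope (κ : ℝ) : Continuous (localSlope κ) := by
  unfold localSlope; fun_prop

theorem hasDerivAt_localScore (κ u : ℝ) : HasDerivAt (localScore κ) (localSlope κ u) u := by
  have h1 : HasDerivAt (fun u => Real.arctan (u / κ)) (cauchyBump (u / κ) * κ⁻¹) u := by
    have := (hasDerivAt_arctan_cauchyBump (u / κ)).comp u ((hasDerivAt_id u).div_const κ)
    simpa [Function.comp_def] using this
  have h2 : HasDerivAt cauchyBump (-(2 * u * cauchyBump u ^ 2)) u := by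
    have h3 : HasDerivAt (fun u : ℝ => 1 + u ^ 2) (2 * u) u := by
      simpa using ((hasDerivAt_id u).pow 2).const_add 1
    refine (h3.inv (by positivity)).congr_deriv ?_
    unfold cauchyBump
    field_simp
  refine (h1.mul h2).congr_deriv ?_
  unfold localSlope
  ring

theorem abs_localScore_le (κ u : ℝ) : |localScore κ u| ≤ 2 * cauchyBump u := by
  rw [localScore, abs_mul, abs_of_pos (cauchyBump_pos u)]
  exact mul_le_mul_of_nonneg_right (abs_arctan_le_two _) (cauchyBump_pos u).le

theorem abs_arctan_mul_le (κ u : ℝ) :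
    |Real.arctan (u / κ) * (2 * u * cauchyBump u ^ 2)| ≤ 2 * cauchyBump u := by
  have h : |2 * u| * cauchyBump u ≤ 1 := by
    unfold cauchyBump
    rw [← div_eq_mul_inv, div_le_one (by positivity), abs_mul, abs_two]
    nlinarith [sq_nonneg (|u| - 1), sq_abs u]
  have hp := cauchyBump_pos u
  rw [abs_mul]
  refine mul_le_mul (abs_arctan_le_two _) ?_ (abs_nonneg _) zero_le_two
  rw [abs_mul, abs_of_pos (by positivity : 0 < cauchyBump u ^ 2), sq, ← mul_assoc]
  nlinarith

/-- Differentiating the cutoff gives the only negative contribution. It lacks the factor `κ⁻¹` of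
the steep part, so it becomes small after multiplication by `κ`. -/
theorem le_mul_localSlope {κ : ℝ} (hκ : 0 < κ) (u : ℝ) :
    cauchyBump (u / κ) * cauchyBump u - 2 * κ * cauchyBump u ≤ κ * localSlope κ u := by
  have h := (abs_le.1 (abs_arctan_mul_le κ u)).2
  have e : κ * localSlope κ u = cauchyBump (u / κ) * cauchyBump u -
      κ * (Real.arctan (u / κ) * (2 * u * cauchyBump u ^ 2)) := by
    unfold localSlope; field_simp
  rw [e]
  nlinarith

theorem abs_mul_localSlope_le {κ : ℝ} (hκ : 0 < κ) (hκ1 : κ ≤ 1) (u : ℝ) :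
    |κ * localSlope κ u| ≤ 3 * cauchyBump u := by
  have h := abs_arctan_mul_le κ u
  have e : κ * localSlope κ u = cauchyBump (u / κ) * cauchyBump u -
      κ * (Real.arctan (u / κ) * (2 * u * cauchyBump u ^ 2)) := by
    unfold localSlope; field_simp
  have hp := cauchyBump_pos u
  have h1 : |cauchyBump (u / κ) * cauchyBump u| ≤ cauchyBump u := by
    rw [abs_mul, abs_of_pos hp]
    nlinarith [abs_cauchyBump_le_one (u / κ)]
  have h2 : |κ * (Real.arctan (u / κ) * (2 * u * cauchyBump u ^ 2))| ≤ 2 * cauchyBump u := by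
    rw [abs_mul, abs_of_pos hκ]
    nlinarith [abs_nonneg (Real.arctan (u / κ) * (2 * u * cauchyBump u ^ 2))]
  rw [e]
  exact (abs_sub _ _).trans (by linarith)

/-! ### Averages of bumps under Gaussian weights -/

section Weighted

variable {d : ℕ} {w γ : Fin d → ℝ}

theorem integrable_weight (hw : ∀ j, 0 ≤ w j) :
    Integrable (fun x => gaussianWeight w x) (gaussianPi d) :=
  Integrable.of_bound (by fun_prop) 1 (ae_of_all _ fun x => by
    rw [Real.norm_eq_abs, abs_of_pos (gaussianWeight_pos w x)]; exact gaussianWeight_le_one hw x)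

theorem integrable_weight_mul (hw : ∀ j, 0 ≤ w j) {f : (Fin d → ℝ) → ℝ} (hf : Continuous f)
    {C : ℝ} (hC : ∀ x, |f x| ≤ C) :
    Integrable (fun x => gaussianWeight w x * f x) (gaussianPi d) :=
  (integrable_weight hw).mul_bdd (c := C) hf.aestronglyMeasurable (ae_of_all _ hC)

theorem integral_weight_mul_sq_le_self (hw : ∀ j, 0 ≤ w j) (hγ : ∑ j, γ j ^ 2 ≤ 1) :
    ∫ x, gaussianWeight w x * (∑ j, γ j * x j) ^ 2 ∂gaussianPi d ≤
      ∫ x, gaussianWeight w x ∂gaussianPi d := by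
  have h := integral_weight_mul_sq_le w 0 le_rfl hw γ
  have hW : 0 ≤ ∫ x, gaussianWeight w x ∂gaussianPi d :=
    integral_nonneg fun x => (gaussianWeight_pos w x).le
  nlinarith

theorem le_integral_weight_mul_cauchyBump (hw : ∀ j, 0 ≤ w j) (hγ : ∑ j, γ j ^ 2 ≤ 1) (z : ℝ) :
    (∫ x, gaussianWeight w x ∂gaussianPi d) / 4 * cauchyBump z ≤
      ∫ x, gaussianWeight w x * cauchyBump (∑ j, γ j * x j + z) ∂gaussianPi d := by
  have h := integral_weight_mul_sq_le_self hw hγ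
  have hz := cauchyBump_pos z
  have i1 := (integrable_weight hw).const_mul (3 / 4 * (cauchyBump z / 2))
  have i2 := (integrable_weight_mul_sq w hw γ).const_mul (1 / 4 * (cauchyBump z / 2))
  have hm : ∫ x, (3 / 4 * (cauchyBump z / 2) * gaussianWeight w x - 1 / 4 * (cauchyBump z / 2) *
      (gaussianWeight w x * (∑ j, γ j * x j) ^ 2)) ∂gaussianPi d ≤
      ∫ x, gaussianWeight w x * cauchyBump (∑ j, γ j * x j + z) ∂gaussianPi d := by
    refine integral_mono (i1.sub i2)
      (integrable_weight_mul hw (by fun_prop) fun x => abs_cauchyBump_le_one _) fun x => ?_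
    have h1 := cauchyBump_mul_le (∑ j, γ j * x j) z
    have h2 := mul_le_mul_of_nonneg_right (le_cauchyBump (∑ j, γ j * x j)) (half_pos hz).le
    have h3 := mul_le_mul_of_nonneg_left (h2.trans (by linarith)) (gaussianWeight_pos w x).le
      (c := cauchyBump (∑ j, γ j * x j + z))
    simp only
    linarith
  rw [integral_sub i1 i2, integral_const_mul, integral_const_mul] at hm
  nlinarith

theorem integral_weight_mul_cauchyBump_le (hw : ∀ j, 0 ≤ w j) (hγ : ∑ j, γ j ^ 2 ≤ 1) (z : ℝ) :
    ∫ x, gaussianWeight w x * cauchyBump (∑ j, γ j * x j + z) ∂gaussianPi d ≤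
      4 * (∫ x, gaussianWeight w x ∂gaussianPi d) * cauchyBump z := by
  have h := integral_weight_mul_sq_le_self hw hγ
  have hz := cauchyBump_pos z
  have i1 := (integrable_weight hw).const_mul (2 * cauchyBump z)
  have i2 := (integrable_weight_mul_sq w hw γ).const_mul (2 * cauchyBump z)
  have hm : ∫ x, gaussianWeight w x * cauchyBump (∑ j, γ j * x j + z) ∂gaussianPi d ≤
      ∫ x, (2 * cauchyBump z * gaussianWeight w x + 2 * cauchyBump z *
      (gaussianWeight w x * (∑ j, γ j * x j) ^ 2)) ∂gaussianPi d := by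
    refine integral_mono (integrable_weight_mul hw (by fun_prop) fun x => abs_cauchyBump_le_one _)
      (i1.add i2) fun x => ?_
    have h3 := mul_le_mul_of_nonneg_left (cauchyBump_add_le (∑ j, γ j * x j) z)
      (gaussianWeight_pos w x).le
    simp only
    linarith
  rw [integral_add i1 i2, integral_const_mul, integral_const_mul] at hm
  nlinarith

/-- Under the weight, `⟨γ, x⟩` has second moment at most `1 / (1 + a) ≤ κ² / 4` relative to the
total mass, so it mostly stays where both bumps are of order one. -/
theorem le_integral_weight_mul_cauchyBump_mul {a κ : ℝ} (ha : 0 ≤ a) (hw : ∀ j, a ≤ w j)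
    (hγ : ∑ j, γ j ^ 2 ≤ 1) (hκ : 0 < κ) (hκ1 : κ ≤ 1) (haκ : 4 ≤ (1 + a) * κ ^ 2) :
    (∫ x, gaussianWeight w x ∂gaussianPi d) / 2 ≤
      ∫ x, gaussianWeight w x * (cauchyBump ((∑ j, γ j * x j) / κ) * cauchyBump (∑ j, γ j * x j))
        ∂gaussianPi d := by
  have hw0 : ∀ j, 0 ≤ w j := fun j => ha.trans (hw j)
  have h := integral_weight_mul_sq_le w a ha hw γ
  have hW : 0 ≤ ∫ x, gaussianWeight w x ∂gaussianPi d :=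
    integral_nonneg fun x => (gaussianWeight_pos w x).le
  have hV : 0 ≤ ∫ x, gaussianWeight w x * (∑ j, γ j * x j) ^ 2 ∂gaussianPi d :=
    integral_nonneg fun x => mul_nonneg (gaussianWeight_pos w x).le (sq_nonneg _)
  have i1 := integrable_weight (w := w) hw0
  have i2 := (integrable_weight_mul_sq w hw0 γ).const_mul (2 / κ ^ 2)
  have hm : ∫ x, (gaussianWeight w x - 2 / κ ^ 2 * (gaussianWeight w x * (∑ j, γ j * x j) ^ 2))
      ∂gaussianPi d ≤ ∫ x, gaussianWeight w x *
        (cauchyBump ((∑ j, γ j * x j) / κ) * cauchyBump (∑ j, γ j * x j)) ∂gaussianPi d := by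
    refine integral_mono (i1.sub i2) (integrable_weight_mul hw0 (C := 1) (by fun_prop) fun x => ?_)
      fun x => ?_
    · rw [abs_mul]
      exact mul_le_one₀ (abs_cauchyBump_le_one _) (abs_nonneg _) (abs_cauchyBump_le_one _)
    -- Uses `A B ≥ A + B - 1` for `A, B ≤ 1`.
    · have hpt : ∀ t : ℝ, 1 - 2 / κ ^ 2 * t ^ 2 ≤ cauchyBump (t / κ) * cauchyBump t := fun t => by
        have h1 := one_sub_le_cauchyBump (t / κ)
        have h2 := one_sub_le_cauchyBump t
        have h3 : t ^ 2 ≤ (t / κ) ^ 2 := by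
          rw [div_pow, le_div_iff₀ (by positivity)]
          nlinarith [sq_nonneg t, mul_nonneg (sq_nonneg t) (by nlinarith : 0 ≤ 1 - κ ^ 2)]
        have e : 2 / κ ^ 2 * t ^ 2 = 2 * (t / κ) ^ 2 := by rw [div_pow]; ring
        rw [e]
        nlinarith [cauchyBump_le_one t, cauchyBump_le_one (t / κ), cauchyBump_pos t,
          cauchyBump_pos (t / κ)]
      have := mul_le_mul_of_nonneg_left (hpt (∑ j, γ j * x j)) (gaussianWeight_pos w x).le
      simp only
      linarith
  rw [integral_sub i1 i2, integral_const_mul] at hm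
  have h4 : 2 / κ ^ 2 * ∫ x, gaussianWeight w x * (∑ j, γ j * x j) ^ 2 ∂gaussianPi d ≤
      (∫ x, gaussianWeight w x ∂gaussianPi d) / 2 := by
    rw [div_mul_eq_mul_div, div_le_div_iff₀ (by positivity) two_pos]
    nlinarith [mul_le_mul_of_nonneg_right hγ hW, mul_le_mul_of_nonneg_right haκ hV,
      mul_le_mul_of_nonneg_left h (sq_nonneg κ)]
  linarith

/-- Makes the unbounded factor `x i` admissible in a bounded query; this is why the weight of the
queried coordinate must be at least `1`. -/
theorem abs_eval_mul_weight_le_one (hw : ∀ j, 0 ≤ w j) (i : Fin d) (hi : 1 ≤ w i)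
    (x : Fin d → ℝ) : |x i| * gaussianWeight w x ≤ 1 := by
  have h1 : gaussianWeight w x ≤ Real.exp (-(x i ^ 2 / 2)) := by
    refine Real.exp_le_exp.2 (neg_le_neg ?_)
    have := Finset.single_le_sum (f := fun j => w j * x j ^ 2 / 2)
      (fun j _ => by have := hw j; positivity) (Finset.mem_univ i)
    nlinarith [sq_nonneg (x i)]
  have h2 : |x i| ≤ Real.exp (x i ^ 2 / 2) := by
    have := Real.add_one_le_exp (x i ^ 2 / 2)
    nlinarith [sq_nonneg (|x i| - 1), sq_abs (x i)]
  calc |x i| * gaussianWeight w x ≤ Real.exp (x i ^ 2 / 2) * Real.exp (-(x i ^ 2 / 2)) := by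
        gcongr
        exact (gaussianWeight_pos w x).le
    _ = 1 := by rw [← Real.exp_add]; simp

end Weighted

/-! ### The regression model, residuals and queried functions -/

instance isProbabilityMeasure_obliviousRegression (d : ℕ) (β : EuclideanSpace ℝ (Fin d))
    (E : Measure ℝ) [IsProbabilityMeasure E] :
    IsProbabilityMeasure (obliviousRegression d β E) :=
  Measure.isProbabilityMeasure_map (by fun_prop)

theorem integral_obliviousRegression {d : ℕ} (β : EuclideanSpace ℝ (Fin d))
    (E : Measure ℝ) [IsProbabilityMeasure E] (f : EuclideanSpace ℝ (Fin d) × ℝ → ℝ)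
    (hf : Measurable f) {C : ℝ} (hC : ∀ p, |f p| ≤ C) :
    ∫ p, f p ∂obliviousRegression d β E =
      ∫ z, ∫ x, f (WithLp.toLp 2 x, inner ℝ (WithLp.toLp 2 x) β + z) ∂gaussianPi d ∂E := by
  have hT : Measurable fun p : EuclideanSpace ℝ (Fin d) × ℝ => (p.1, inner ℝ p.1 β + p.2) := by
    fun_prop
  rw [obliviousRegression, integral_map hT.aemeasurable hf.aestronglyMeasurable,
    integral_prod_symm]
  · refine integral_congr_ae (ae_of_all _ fun z => ?_)
    simp only
    rw [← map_pi_eq_stdGaussian, integral_map]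
    · exact (by fun_prop : Measurable (WithLp.toLp 2 : (Fin d → ℝ) → _)).aemeasurable
    · exact (hf.comp (by fun_prop)).aestronglyMeasurable
  · exact Integrable.of_bound (hf.comp hT).aestronglyMeasurable C (ae_of_all _ fun p => hC _)

/-- The rescaled regResidual of the response. -/
noncomputable def regResidual {d : ℕ} (b : EuclideanSpace ℝ (Fin d)) (δ : ℝ)
    (p : EuclideanSpace ℝ (Fin d) × ℝ) : ℝ := (p.2 - inner ℝ p.1 b) / δ

@[fun_prop]
theorem measurable_regResidual {d : ℕ} (b : EuclideanSpace ℝ (Fin d)) (δ : ℝ) :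
    Measurable (regResidual b δ) := by unfold regResidual; fun_prop

theorem regResidual_apply {d : ℕ} (b β : EuclideanSpace ℝ (Fin d)) (δ z : ℝ) (x : Fin d → ℝ) :
    regResidual b δ (WithLp.toLp 2 x, inner ℝ (WithLp.toLp 2 x) β + z) =
      ∑ j, (β j - b j) / δ * x j + z / δ := by
  simp only [regResidual, PiLp.inner_apply, RCLike.inner_apply, conj_trivial]
  rw [add_sub_right_comm, add_div, ← Finset.sum_sub_distrib, Finset.sum_div]
  congr 1
  exact Finset.sum_congr rfl fun j _ => by ring

/-- A weighted correlation of a coordinate of `x` with a function of the regResidual. -/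
noncomputable def scoreQuery {d : ℕ} (w : Fin d → ℝ) (g : ℝ → ℝ) (δ : ℝ)
    (b : EuclideanSpace ℝ (Fin d)) (i : Fin d) (p : EuclideanSpace ℝ (Fin d) × ℝ) : ℝ :=
  p.1 i * (gaussianWeight w p.1.ofLp * g (regResidual b δ p)) / 3

/-- A weighted function of the regResidual. -/
noncomputable def slopeQuery {d : ℕ} (w : Fin d → ℝ) (h : ℝ → ℝ) (δ : ℝ)
    (b : EuclideanSpace ℝ (Fin d)) (p : EuclideanSpace ℝ (Fin d) × ℝ) : ℝ :=
  gaussianWeight w p.1.ofLp * h (regResidual b δ p) / 3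

/-! ### Means of the score and slope queries -/

section Means

variable {d : ℕ} (w : Fin d → ℝ) (g h : ℝ → ℝ) (δ : ℝ) (b β : EuclideanSpace ℝ (Fin d))
  (i : Fin d)

theorem measurable_scoreQuery (hg : Measurable g) : Measurable (scoreQuery w g δ b i) := by
  unfold scoreQuery
  have := continuous_gaussianWeight w
  fun_prop

theorem measurable_slopeQuery (hh : Measurable h) : Measurable (slopeQuery w h δ b) := by
  unfold slopeQuery
  have := continuous_gaussianWeight w
  fun_prop

variable {w g h δ}

theorem abs_scoreQuery_le (hw : ∀ j, 0 ≤ w j) (hi : 1 ≤ w i)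
    (p : EuclideanSpace ℝ (Fin d) × ℝ) :
    |scoreQuery w g δ b i p| ≤ |g (regResidual b δ p)| / 3 := by
  rw [scoreQuery, abs_div, abs_mul, abs_mul, abs_of_pos (gaussianWeight_pos _ _),
    abs_of_pos (three_pos : (0 : ℝ) < 3), ← mul_assoc]
  have := abs_eval_mul_weight_le_one hw i hi p.1.ofLp
  have := mul_le_mul_of_nonneg_right this (abs_nonneg (g (regResidual b δ p)))
  linarith

theorem abs_slopeQuery_le (hw : ∀ j, 0 ≤ w j) (p : EuclideanSpace ℝ (Fin d) × ℝ) :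
    |slopeQuery w h δ b p| ≤ |h (regResidual b δ p)| / 3 := by
  rw [slopeQuery, abs_div, abs_mul, abs_of_pos (gaussianWeight_pos _ _),
    abs_of_pos (three_pos : (0 : ℝ) < 3)]
  have := mul_le_mul_of_nonneg_right (gaussianWeight_le_one hw p.1.ofLp)
    (abs_nonneg (h (regResidual b δ p)))
  linarith

theorem mul_le_integral_of_nonneg (E : Measure ℝ) {f : ℝ → ℝ} (hf : Integrable f E) (h0 : ∀ z, 0 ≤ f z) :
    E.real {0} * f 0 ≤ ∫ z, f z ∂E := by
  have := setIntegral_le_integral (s := {0}) hf (ae_of_all _ h0)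
  rwa [integral_singleton, smul_eq_mul] at this

variable (E : Measure ℝ) [IsProbabilityMeasure E]

/-- The Stein identity that the regression estimator relies on. -/
theorem integral_scoreQuery_eq {κ A : ℝ} {dg : ℝ → ℝ} (hw : ∀ j, 0 ≤ w j) (hi : 1 ≤ w i)
    (hg : ∀ u, HasDerivAt g (dg u) u) (hdg : Continuous dg) (hg3 : ∀ u, |g u| ≤ 3)
    (hbd : ∀ u, |dg u| ≤ A) (hκ3 : ∀ u, |κ * dg u| ≤ 3) :
    (1 + w i) * κ * ∫ p, scoreQuery w g δ b i p ∂obliviousRegression d β E =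
      (β i - b i) / δ * ∫ p, slopeQuery w (fun u => κ * dg u) δ b p ∂obliviousRegression d β E := by
  have hgc : Continuous g := continuous_iff_continuousAt.2 fun u => (hg u).continuousAt
  rw [integral_obliviousRegression β E _ (measurable_scoreQuery w g δ b i hgc.measurable) (C := 1)
      fun p => (abs_scoreQuery_le b i hw hi p).trans (by linarith [hg3 (regResidual b δ p)]),
    integral_obliviousRegression β E _ (measurable_slopeQuery w _ δ b (by fun_prop)) (C := 1)
      fun p => (abs_slopeQuery_le b hw p).trans (by linarith [hκ3 (regResidual b δ p)]),
    ← integral_const_mul, ← integral_const_mul]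
  congr 1; ext z
  simp only [scoreQuery, slopeQuery, regResidual_apply]
  have hA : 0 ≤ A := (abs_nonneg _).trans (hbd 0)
  -- `A + 3` bounds both `g` and its derivative.
  have key := stein_gaussianWeight w hw (fun j => (β j - b j) / δ) (z / δ) (A + 3) g dg hg hdg
    (fun u => (hg3 u).trans (by nlinarith [abs_nonneg u])) (fun u => (hbd u).trans (by linarith)) i
  have e : ∀ x : Fin d → ℝ, gaussianWeight w x *
      (κ * dg (∑ j, (β j - b j) / δ * x j + z / δ)) / 3 =
      κ / 3 * (gaussianWeight w x * dg (∑ j, (β j - b j) / δ * x j + z / δ)) := fun x => by ring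
  simp_rw [e]
  rw [integral_const_mul, integral_div]
  linear_combination (κ / 3) * key

/-- The mass of the noise near the origin, at scale `δ`. -/
noncomputable def noiseMass (δ : ℝ) (E : Measure ℝ) : ℝ := ∫ z, cauchyBump (z / δ) ∂E

theorem integrable_cauchyBump_div : Integrable (fun z => cauchyBump (z / δ)) E :=
  Integrable.of_bound (by fun_prop) 1 (ae_of_all _ fun _ => abs_cauchyBump_le_one _)

theorem real_singleton_le_noiseMass : E.real {0} ≤ noiseMass δ E := by
  have := mul_le_integral_of_nonneg E (integrable_cauchyBump_div (δ := δ) E)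
    fun z => (cauchyBump_pos _).le
  simpa [cauchyBump, noiseMass] using this

theorem integrable_integral_weight_mul (γ : Fin d → ℝ) (hw : ∀ j, 0 ≤ w j) (hh : Continuous h)
    {C : ℝ} (hC : ∀ u, |h u| ≤ C) :
    Integrable (fun z => ∫ x, gaussianWeight w x * h (∑ j, γ j * x j + z / δ) ∂gaussianPi d) E := by
  have : Integrable (fun p : (Fin d → ℝ) × ℝ =>
      gaussianWeight w p.1 * h (∑ j, γ j * p.1 j + p.2 / δ)) ((gaussianPi d).prod E) := by
    refine Integrable.of_bound
      (Continuous.aestronglyMeasurable ?_) C (ae_of_all _ fun p => ?_)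
    · have := continuous_gaussianWeight w
      fun_prop
    · rw [Real.norm_eq_abs, abs_mul, abs_of_pos (gaussianWeight_pos _ _)]
      exact (mul_le_of_le_one_left (abs_nonneg _) (gaussianWeight_le_one hw _)).trans (hC _)
  exact this.integral_prod_right

theorem integral_integral_cauchyBump_le {γ : Fin d → ℝ} (hw : ∀ j, 0 ≤ w j)
    (hγ : ∑ j, γ j ^ 2 ≤ 1) :
    ∫ z, ∫ x, gaussianWeight w x * cauchyBump (∑ j, γ j * x j + z / δ) ∂gaussianPi d ∂E ≤
      4 * (∫ x, gaussianWeight w x ∂gaussianPi d) * noiseMass δ E := by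
  rw [noiseMass, ← integral_const_mul]
  exact integral_mono (integrable_integral_weight_mul E γ hw continuous_cauchyBump
    abs_cauchyBump_le_one) ((integrable_cauchyBump_div E).const_mul _)
    fun z => integral_weight_mul_cauchyBump_le hw hγ _

theorem integral_cauchyBump_residual_le (hγ : ∑ j, ((β j - b j) / δ) ^ 2 ≤ 1) :
    ∫ p, cauchyBump (regResidual b δ p) ∂obliviousRegression d β E ≤ 4 * noiseMass δ E := by
  rw [integral_obliviousRegression β E _ (by fun_prop) fun p => abs_cauchyBump_le_one _]
  simp_rw [regResidual_apply]
  have := integral_integral_cauchyBump_le (w := fun _ => 0) (δ := δ) E (fun _ => le_rfl) hγ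
  simpa [gaussianWeight] using this

/-- Bounds the mean of a localized query by the noise mass, and thereby its VSTAT error. -/
theorem integral_abs_le_of_le_cauchyBump (hγ : ∑ j, ((β j - b j) / δ) ^ 2 ≤ 1)
    {F : EuclideanSpace ℝ (Fin d) × ℝ → ℝ} (hF : Measurable F)
    (hb : ∀ p, |F p| ≤ cauchyBump (regResidual b δ p)) :
    ∫ p, |F p| ∂obliviousRegression d β E ≤ 4 * noiseMass δ E := by
  refine le_trans (integral_mono ?_ ?_ hb) (integral_cauchyBump_residual_le b β E hγ)
  · exact Integrable.of_bound hF.abs.aestronglyMeasurable 1 (ae_of_all _ fun p => by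
      rw [Real.norm_eq_abs, abs_abs]; exact (hb p).trans (cauchyBump_le_one _))
  · refine Integrable.of_bound ?_ 1 (ae_of_all _ fun p => abs_cauchyBump_le_one _)
    exact (by fun_prop : Measurable fun p => cauchyBump (regResidual b δ p)).aestronglyMeasurable

theorem le_integral_slopeQuery_cauchyBump (hw : ∀ j, 0 ≤ w j)
    (hγ : ∑ j, ((β j - b j) / δ) ^ 2 ≤ 1) :
    (∫ x, gaussianWeight w x ∂gaussianPi d) / 12 * noiseMass δ E ≤
      ∫ p, slopeQuery w cauchyBump δ b p ∂obliviousRegression d β E := by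
  rw [integral_obliviousRegression β E _ (measurable_slopeQuery w _ δ b (by fun_prop)) (C := 1)
      fun p => (abs_slopeQuery_le b hw p).trans
        (by linarith [abs_cauchyBump_le_one (regResidual b δ p)])]
  simp_rw [slopeQuery, regResidual_apply, integral_div]
  rw [le_div_iff₀ three_pos, noiseMass, mul_right_comm, ← integral_const_mul]
  refine integral_mono ((integrable_cauchyBump_div E).const_mul _)
    (integrable_integral_weight_mul E _ hw continuous_cauchyBump abs_cauchyBump_le_one) fun z => ?_
  have := le_integral_weight_mul_cauchyBump hw hγ (z / δ)
  simp only
  linarith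

/-- With `W` the mass of the weight, the atom of the noise contributes at least `α W / 2`. The
cutoff removes at most `2 κ · 4 W · noiseMass ≤ α W / 4` by `hm`. The rest is divided by the
normalization `3`. -/
theorem le_integral_slopeQuery_localSlope {a κ α : ℝ} (ha : 0 ≤ a) (hw : ∀ j, a ≤ w j)
    (hγ : ∑ j, ((β j - b j) / δ) ^ 2 ≤ 1) (hκ : 0 < κ) (hκ1 : κ ≤ 1) (haκ : 4 ≤ (1 + a) * κ ^ 2)
    (hα : α ≤ E.real {0}) (hm : 8 * κ * noiseMass δ E ≤ α / 4) :
    (∫ x, gaussianWeight w x ∂gaussianPi d) * α / 12 ≤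
      ∫ p, slopeQuery w (fun u => κ * localSlope κ u) δ b p ∂obliviousRegression d β E := by
  have hw0 : ∀ j, 0 ≤ w j := fun j => ha.trans (hw j)
  have hW : 0 ≤ ∫ x, gaussianWeight w x ∂gaussianPi d :=
    integral_nonneg fun x => (gaussianWeight_pos w x).le
  have hb3 : ∀ u, |κ * localSlope κ u| ≤ 3 := fun u =>
    (abs_mul_localSlope_le hκ hκ1 u).trans (by linarith [cauchyBump_le_one u])
  rw [integral_obliviousRegression β E _ (measurable_slopeQuery w _ δ b (by fun_prop)) (C := 1)
      fun p => (abs_slopeQuery_le b hw0 p).trans (by linarith [hb3 (regResidual b δ p)])]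
  simp_rw [slopeQuery, regResidual_apply, integral_div]
  rw [le_div_iff₀ three_pos]
  set γ : Fin d → ℝ := fun j => (β j - b j) / δ
  have hAb : ∀ u, |cauchyBump (u / κ) * cauchyBump u| ≤ 1 := fun u => by
    rw [abs_mul]
    exact mul_le_one₀ (abs_cauchyBump_le_one _) (abs_nonneg _) (abs_cauchyBump_le_one _)
  have iA := integrable_integral_weight_mul (δ := δ) E γ hw0
    (h := fun u => cauchyBump (u / κ) * cauchyBump u) (by fun_prop) hAb
  have iB := integrable_integral_weight_mul (δ := δ) E γ hw0 continuous_cauchyBump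
    abs_cauchyBump_le_one
  have iL := integrable_integral_weight_mul (δ := δ) E γ hw0
    (h := fun u => κ * localSlope κ u) (by fun_prop) hb3
  -- The steep part is nonnegative, so only the atom `z = 0` is kept.
  have h1 := mul_le_integral_of_nonneg E iA fun z => integral_nonneg fun x =>
    mul_nonneg (gaussianWeight_pos w x).le (mul_pos (cauchyBump_pos _) (cauchyBump_pos _)).le
  have h2 := le_integral_weight_mul_cauchyBump_mul ha hw hγ hκ hκ1 haκ
  have h3 := integral_integral_cauchyBump_le (δ := δ) E hw0 hγ
  have hm' := integral_mono (iA.sub (iB.const_mul (2 * κ))) iL fun z => by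
    simp only [Pi.sub_apply]
    rw [← integral_const_mul, ← integral_sub
      (integrable_weight_mul (C := 1) hw0 (by fun_prop) fun x => hAb _)
      ((integrable_weight_mul hw0 (by fun_prop) fun x => abs_cauchyBump_le_one _).const_mul _)]
    refine integral_mono (((integrable_weight_mul (C := 1) hw0 (by fun_prop) fun x => hAb _)).sub
      ((integrable_weight_mul hw0 (by fun_prop) fun x => abs_cauchyBump_le_one _).const_mul _))
      (integrable_weight_mul (C := 3) hw0 (by fun_prop) fun x => hb3 _) fun x => ?_
    have := mul_le_mul_of_nonneg_left (le_mul_localSlope hκ (∑ j, γ j * x j + z / δ))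
      (gaussianWeight_pos w x).le
    simp only
    linarith
  simp only [Pi.sub_apply] at hm'
  rw [integral_sub iA (iB.const_mul _), integral_const_mul] at hm'
  simp only [zero_div, add_zero] at h1
  refine le_trans ?_ hm'
  have h4 : α * ((∫ x, gaussianWeight w x ∂gaussianPi d) / 2) ≤
      ∫ z, ∫ x, gaussianWeight w x * (cauchyBump ((∑ j, γ j * x j + z / δ) / κ) *
        cauchyBump (∑ j, γ j * x j + z / δ)) ∂gaussianPi d ∂E :=
    le_trans (mul_le_mul hα h2 (by positivity) measureReal_nonneg) h1
  nlinarith [mul_le_mul_of_nonneg_left h3 hκ.le, mul_le_mul_of_nonneg_left hm hW]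

end Means

/-! ### Error of the ratio estimators -/

/-- Stability of the ratio estimator under perturbations of numerator and denominator. -/
theorem abs_ratio_sub_le {w κ γ N D N' D' D₀ η : ℝ} (hw : 0 ≤ w) (hκ : 0 ≤ κ) (hκ1 : κ ≤ 1)
    (hγ : |γ| ≤ 1) (h : (1 + w) * κ * N = γ * D) (hN : |N' - N| ≤ η) (hD : |D' - D| ≤ η)
    (hD₀ : 0 < D₀) (hD₀' : D₀ ≤ D) (hη : 2 * η ≤ D₀) :
    |(1 + w) * κ * N' / D' - γ| ≤ 4 * (1 + w) * η / D₀ := by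
  have h1 := abs_le.1 hD
  have hη0 : 0 ≤ η := (abs_nonneg _).trans hN
  have hpos : D₀ / 2 ≤ D' := by linarith
  have hpos' : 0 < D' := by linarith
  have e : (1 + w) * κ * N' / D' - γ = ((1 + w) * κ * (N' - N) - γ * (D' - D)) / D' := by
    field_simp
    linear_combination h
  have hb : |(1 + w) * κ * (N' - N) - γ * (D' - D)| ≤ 2 * (1 + w) * η := by
    refine (abs_sub _ _).trans ?_
    rw [abs_mul ((1 + w) * κ), abs_mul γ, abs_of_nonneg (by positivity : 0 ≤ (1 + w) * κ)]
    have h2 : (1 + w) * κ * |N' - N| ≤ (1 + w) * 1 * η := by gcongr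
    have h3 : |γ| * |D' - D| ≤ 1 * η := by gcongr
    nlinarith
  rw [e, abs_div, abs_of_pos hpos', div_le_div_iff₀ hpos' hD₀]
  calc _ ≤ 2 * (1 + w) * η * D₀ := by gcongr
    _ ≤ 4 * (1 + w) * η * D' := by
        have : 0 ≤ (1 + w) * η := by positivity
        nlinarith

theorem abs_sigmoid_estimate_sub_le {q α Θ γ N D N' D' : ℝ} (hα : 0 < α) (hq0 : 0 ≤ q)
    (hq : 10 ^ 7 * q ≤ α) (hΘ : 1 ≤ Θ) (hγ : |γ| ≤ 1) (h : 2 * N = γ * D)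
    (hN : |N' - N| ≤ 4 * q) (hD : |D' - D| ≤ 4 * q) (hDα : α / 18 ≤ D)
    (hΘD : Θ ≤ 4000 ∨ Θ * α ≤ D') :
    |2 * N' / D' - γ| ≤ 10 ^ 7 * q / α / Θ := by
  have h' : (1 + 1) * 1 * N = γ * D := by linarith
  -- If `Θ ≤ 4000`, the factor `1 / Θ` is absorbed by the constant `10 ^ 7`; otherwise the slope
  -- itself is at least `Θ α / 2`.
  rcases hΘD with h1 | h1
  · have := abs_ratio_sub_le zero_le_one zero_le_one le_rfl hγ h' hN hD
      (by positivity : 0 < α / 18) hDα (by linarith)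
    rw [show (1 + 1) * 1 * N' = 2 * N' by ring] at this
    refine this.trans ?_
    rw [div_div, div_le_div_iff₀ (by positivity) (by positivity)]
    nlinarith [mul_nonneg (mul_nonneg hq0 hα.le) (sub_nonneg.2 h1), mul_nonneg hq0 hα.le]
  · have hΘα : α ≤ Θ * α := by nlinarith
    have h2 := abs_le.1 hD
    have := abs_ratio_sub_le zero_le_one zero_le_one le_rfl hγ h' hN hD
      (by positivity : 0 < Θ * α / 2) (by linarith) (by linarith)
    rw [show (1 + 1) * 1 * N' = 2 * N' by ring] at this
    refine this.trans ?_
    rw [div_div, div_le_div_iff₀ (by positivity) (by positivity)]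
    have := mul_nonneg hq0 (by positivity : 0 ≤ Θ * α)
    nlinarith

/-- The relative error is of order `κ⁻² (3/κ)^d √(Θ α) q / α`. The exponent `4 * d + 12` is chosen
so that the factor in front of `q / α` is at most of order `1 / Θ`. -/
theorem abs_local_estimate_sub_le {q α Θ γ N D N' D' κ a s η : ℝ} (d : ℕ) (hα : 0 < α)
    (hq0 : 0 ≤ q) (hq : 10 ^ 7 * q ≤ α) (hα1 : α ≤ 1) (hΘ : 4000 ≤ Θ)
    (hΘα : Θ ^ (4 * d + 12) * α = 1) (hκ : κ = 1 / (1152 * Θ)) (ha : 1 + a = 4 / κ ^ 2)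
    (hs : s = √(Θ * α))
    (hγ : |γ| ≤ 1) (h : (2 + a) * κ * N = γ * D)
    (hη : η ≤ 2 * (q ^ 2 + 12 * s * q))
    (hN : |N' - N| ≤ η) (hD : |D' - D| ≤ η) (hDα : (κ / 3) ^ d * α / 12 ≤ D) :
    |(2 + a) * κ * N' / D' - γ| ≤ 10 ^ 7 * q / α / Θ := by
  have hΘ0 : 0 < Θ := by linarith
  have hκ0 : 0 < κ := by rw [hκ]; positivity
  have hκ1 : κ ≤ 1 := by rw [hκ, div_le_one (by positivity)]; linarith
  have hs0 : 0 ≤ s := by rw [hs]; positivity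
  have hs2 : s ^ 2 = Θ * α := by rw [hs, Real.sq_sqrt (by positivity)]
  have hqs : q ≤ s := by
    refine le_of_abs_le (abs_le_of_sq_le_sq ?_ hs0)
    rw [hs2]
    nlinarith
  have hη' : η ≤ 26 * s * q := by nlinarith [mul_le_mul_of_nonneg_right hqs hq0]
  have hη0 : 0 ≤ η := (abs_nonneg _).trans hN
  -- Here `3 / κ = 3456 Θ`, which explains the threshold `4000`.
  have h3κ : 3 / κ ≤ Θ ^ 2 := by
    rw [hκ, div_div_eq_mul_div, div_one]
    nlinarith
  have h3κ0 : 0 < 3 / κ := by positivity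
  have hκ5 : 2 + a ≤ 5 / κ ^ 2 := by
    have : 1 ≤ 1 / κ ^ 2 := by
      rw [le_div_iff₀ (by positivity)]; nlinarith
    have e : (5 : ℝ) / κ ^ 2 = 4 / κ ^ 2 + 1 / κ ^ 2 := by ring
    linarith
  have ha0 : 0 ≤ 1 + a := by rw [ha]; positivity
  -- After squaring: `Θ^(4d+8) · Θ α · Θ² = Θ^(4d+11) α ≤ 1`.
  have hX : (3 / κ) ^ (d + 2) * s * Θ ≤ 1 := by
    have h1 : (3 / κ) ^ (d + 2) ≤ Θ ^ (2 * d + 4) := by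
      calc _ ≤ (Θ ^ 2) ^ (d + 2) := by gcongr
        _ = _ := by rw [← pow_mul]; ring_nf
    have h2 : Θ ^ (2 * d + 4) * s * Θ ≤ 1 := by
      refine le_of_abs_le (abs_le_of_sq_le_sq ?_ zero_le_one)
      calc (Θ ^ (2 * d + 4) * s * Θ) ^ 2 = Θ ^ (4 * d + 11) * α := by
            rw [mul_pow, mul_pow, hs2]; ring
        _ ≤ Θ ^ (4 * d + 12) * α := by
            gcongr
            · linarith
            · norm_num
        _ = 1 ^ 2 := by rw [hΘα]; norm_num
    refine le_trans ?_ h2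
    gcongr
  have hmain : 4 * (1 + (1 + a)) * η / ((κ / 3) ^ d * α / 12) ≤ 6240 * q / α / Θ := by
    have e : 4 * (1 + (1 + a)) * η / ((κ / 3) ^ d * α / 12) =
        48 * (2 + a) * η * (3 / κ) ^ d / α := by
      rw [show (3 : ℝ) / κ = (κ / 3)⁻¹ by rw [inv_div], inv_pow]
      field_simp
      ring
    rw [e, div_right_comm]
    gcongr
    calc 48 * (2 + a) * η * (3 / κ) ^ d ≤ 48 * (5 / κ ^ 2) * (26 * s * q) * (3 / κ) ^ d := by
          gcongr
      _ ≤ 6240 * q * ((3 / κ) ^ (d + 2) * s) := by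
          have e2 : (3 / κ) ^ (d + 2) = (3 / κ) ^ d * (9 * (1 / κ ^ 2)) := by
            rw [pow_add, div_pow 3 κ 2]; ring
          rw [e2]
          have : 0 ≤ (3 / κ) ^ d * (1 / κ ^ 2) * (q * s) := by positivity
          calc _ = 6240 * ((3 / κ) ^ d * (1 / κ ^ 2) * (q * s)) := by ring
            _ ≤ 56160 * ((3 / κ) ^ d * (1 / κ ^ 2) * (q * s)) := by linarith
            _ = _ := by ring
      _ ≤ 6240 * q / Θ := by
          rw [le_div_iff₀ hΘ0]
          calc _ = 6240 * q * ((3 / κ) ^ (d + 2) * s * Θ) := by ring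
            _ ≤ 6240 * q * 1 := by gcongr
            _ = _ := mul_one _
  have hD₀ : 0 < (κ / 3) ^ d * α / 12 := by positivity
  -- The bound `hmain` on the relative error already forces the denominator to dominate `η`.
  have hη2 : 2 * η ≤ (κ / 3) ^ d * α / 12 := by
    have h1 : 6240 * q / α / Θ ≤ 1 := by
      rw [div_div, div_le_one (by positivity)]
      nlinarith
    have h2 := hmain.trans h1
    rw [div_le_one hD₀] at h2
    nlinarith [mul_nonneg ha0 hη0]
  have := abs_ratio_sub_le ha0 hκ0.le hκ1 hγ (by linear_combination h) hN hD hD₀ hDα hη2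
  rw [show 1 + (1 + a) = 2 + a by ring] at this hmain
  refine this.trans (hmain.trans ?_)
  gcongr
  norm_num

/-! ### Masses of the weights used by the queries -/

/-- The weights `a` in all coordinates, and one more in the coordinate `i`. -/
noncomputable def coordWeight {d : ℕ} (a : ℝ) (i j : Fin d) : ℝ := a + if j = i then 1 else 0

theorem coordWeight_self {d : ℕ} (a : ℝ) (i : Fin d) : coordWeight a i i = a + 1 := by
  simp [coordWeight]

theorem le_coordWeight {d : ℕ} (a : ℝ) (i j : Fin d) : a ≤ coordWeight a i j := by
  unfold coordWeight; split_ifs <;> linarith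

theorem coordWeight_le {d : ℕ} (a : ℝ) (i j : Fin d) : coordWeight a i j ≤ a + 1 := by
  unfold coordWeight; split_ifs <;> linarith

theorem le_integral_gaussianWeight_coordWeight_zero {d : ℕ} (i : Fin d) :
    2 / 3 ≤ ∫ x, gaussianWeight (coordWeight 0 i) x ∂gaussianPi d := by
  rw [integral_gaussianWeight _ fun j => le_coordWeight 0 i j,
    Finset.prod_eq_single i (fun j _ hj => by simp [coordWeight, hj])
      (fun h => absurd (Finset.mem_univ i) h), coordWeight_self, ← inv_div]
  refine inv_anti₀ (by positivity) ?_
  rw [Real.sqrt_le_left (by norm_num)]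
  norm_num

/-- Each coordinate contributes `(1 + w j)^(-1/2) ≥ κ / 3`. This exponential loss in `d` is the
price of the strong weight. -/
theorem le_integral_gaussianWeight_coordWeight {d : ℕ} (i : Fin d) {a κ : ℝ} (ha : 0 ≤ a)
    (hκ : 0 < κ) (haκ : (2 + a) * κ ^ 2 ≤ 9) :
    (κ / 3) ^ d ≤ ∫ x, gaussianWeight (coordWeight a i) x ∂gaussianPi d := by
  rw [integral_gaussianWeight _ fun j => ha.trans (le_coordWeight a i j)]
  have : (κ / 3) ^ d = ∏ _j : Fin d, κ / 3 := by simp [div_pow]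
  rw [this]
  refine Finset.prod_le_prod (fun _ _ => by positivity) fun j _ => ?_
  rw [← inv_div]
  have h0 := le_coordWeight a i j
  have h1 := coordWeight_le a i j
  refine inv_anti₀ (Real.sqrt_pos.2 (by linarith)) ?_
  rw [Real.sqrt_le_left (by positivity), div_pow, le_div_iff₀ (by positivity)]
  nlinarith [sq_nonneg κ]

/-! ### The algorithm and the contraction in one round -/

namespace ObliviousSQ

/-- The rate `α ^ (-1 / (4 d + 12))`. -/
noncomputable def rate (d : ℕ) (α : ℝ) : ℝ := (1 / α) ^ (1 / ((4 * d + 12 : ℕ) : ℝ))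

theorem one_le_rate (d : ℕ) {α : ℝ} (hα : α ∈ Set.Ioo (0 : ℝ) 1) : 1 ≤ rate d α :=
  Real.one_le_rpow (one_le_one_div hα.1 hα.2.le) (by positivity)

theorem rate_pow_mul (d : ℕ) {α : ℝ} (hα : α ∈ Set.Ioo (0 : ℝ) 1) :
    rate d α ^ (4 * d + 12) * α = 1 := by
  have h0 := hα.1
  rw [rate, one_div ((4 * d + 12 : ℕ) : ℝ), Real.rpow_inv_natCast_pow (by positivity) (by simp)]
  field_simp

/-- The scale of the local queries. -/
noncomputable def scale (Θ : ℝ) : ℝ := 1 / (1152 * Θ)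

/-- The strength of the weight of the local queries. -/
noncomputable def strength (Θ : ℝ) : ℝ := 4 / scale Θ ^ 2 - 1

/-- The bounded functions of the data whose means are queried; the first Boolean selects the local
pair, the second one selects the slope rather than the score. -/
noncomputable def observable {d : ℕ} (Θ δ : ℝ) (b : EuclideanSpace ℝ (Fin d)) (i : Fin d) :
    Bool → Bool → EuclideanSpace ℝ (Fin d) × ℝ → ℝ
  | false, false => scoreQuery (coordWeight 0 i) Real.arctan δ b i
  | false, true => slopeQuery (coordWeight 0 i) cauchyBump δ b
  | true, false => scoreQuery (coordWeight (strength Θ) i) (localScore (scale Θ)) δ b i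
  | true, true => slopeQuery (coordWeight (strength Θ) i)
      (fun u => scale Θ * localSlope (scale Θ) u) δ b

theorem measurable_observable {d : ℕ} (Θ δ : ℝ) (b : EuclideanSpace ℝ (Fin d)) (i : Fin d)
    (l s : Bool) : Measurable (observable Θ δ b i l s) := by
  cases l <;> cases s
  · exact measurable_scoreQuery _ _ _ _ _ (by fun_prop)
  · exact measurable_slopeQuery _ _ _ _ (by fun_prop)
  · exact measurable_scoreQuery _ _ _ _ _ (by fun_prop)
  · exact measurable_slopeQuery _ _ _ _
      (by fun_prop : Continuous fun u => scale Θ * localSlope (scale Θ) u).measurable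

/-- The statistical queries of a round; the last Boolean selects the sign. -/
noncomputable def queries {d : ℕ} (Θ δ : ℝ) (b : EuclideanSpace ℝ (Fin d))
    (I : Fin d × Bool × Bool × Bool) : StatQuery (EuclideanSpace ℝ (Fin d) × ℝ) :=
  match I with
  | (i, l, s, false) => StatQuery.clip (observable Θ δ b i l s) (measurable_observable ..)
  | (i, l, s, true) => StatQuery.clip (fun p => -observable Θ δ b i l s p)
      (measurable_observable ..).neg

/-- The estimate of the mean of an observable. -/
def meanEstimate {d : ℕ} (v : Fin d × Bool × Bool × Bool → ℝ) (i : Fin d) (l s : Bool) : ℝ :=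
  v (i, l, s, false) - v (i, l, s, true)

open Classical in
/-- The estimate of a rescaled coordinate of the error. -/
noncomputable def coordEstimate {d : ℕ} (Θ α : ℝ) (v : Fin d × Bool × Bool × Bool → ℝ)
    (i : Fin d) : ℝ :=
  if Θ ≤ 4000 ∨ Θ * α ≤ meanEstimate v i false true then
    2 * meanEstimate v i false false / meanEstimate v i false true
  else (2 + strength Θ) * scale Θ * meanEstimate v i true false / meanEstimate v i true true

/-- The estimate after a round. -/
noncomputable def update {d : ℕ} (Θ α δ : ℝ) (b : EuclideanSpace ℝ (Fin d))
    (v : Fin d × Bool × Bool × Bool → ℝ) : EuclideanSpace ℝ (Fin d) :=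
  b + δ • WithLp.toLp 2 (coordEstimate Θ α v)

theorem abs_coordEstimate_sub_le {d m : ℕ} {Θ α δ q : ℝ} {b β : EuclideanSpace ℝ (Fin d)}
    {E : Measure ℝ} [IsProbabilityMeasure E] (hα : α ∈ Set.Ioo (0 : ℝ) 1) (hE : α ≤ E.real {0})
    (hΘ : 1 ≤ Θ) (hΘα : Θ ^ (4 * d + 12) * α = 1)
    (hγ : ∑ j, ((β j - b j) / δ) ^ 2 ≤ 1) (hq0 : 0 ≤ q) (hq : 10 ^ 7 * q ≤ α)
    (hm : 1 / (m : ℝ) ≤ q ^ 2) {v : Fin d × Bool × Bool × Bool → ℝ}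
    (hv : ∀ I, IsVSTATAnswer (obliviousRegression d β E) m (queries Θ δ b I) (v I)) (i : Fin d) :
    |coordEstimate Θ α v i - (β i - b i) / δ| ≤ 10 ^ 7 * q / α / Θ := by
  obtain ⟨hα0, hα1⟩ := hα
  set P := obliviousRegression d β E
  have hγi : |(β i - b i) / δ| ≤ 1 := by
    rw [← sq_le_one_iff_abs_le_one]
    exact (Finset.single_le_sum (f := fun j => ((β j - b j) / δ) ^ 2)
      (fun j _ => sq_nonneg _) (Finset.mem_univ i)).trans hγ
  have hsqrt : ∀ M : ℝ, 0 ≤ M → 2 * (1 / (m : ℝ) + √(M / m)) ≤ 2 * (q ^ 2 + √M * q) := by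
    intro M hM
    have h1 : √(M / m) ≤ √M * q := by
      rw [← Real.sqrt_sq hq0, ← Real.sqrt_mul hM]
      refine Real.sqrt_le_sqrt ?_
      rw [div_eq_mul_one_div]
      gcongr
    linarith
  have hmean : ∀ (l s : Bool) (M : ℝ), 0 ≤ M → (∀ p, |observable Θ δ b i l s p| ≤ 1) →
      ∫ p, |observable Θ δ b i l s p| ∂P ≤ M →
      |meanEstimate v i l s - ∫ p, observable Θ δ b i l s p ∂P| ≤ 2 * (q ^ 2 + √M * q) :=
    fun l s M h0 hb hM => (abs_sub_integral_le_of_answers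
      (hF := measurable_observable ..) (hF' := (measurable_observable ..).neg) hb (hv (i, l, s, false))
      (hv (i, l, s, true)) hM).trans (hsqrt M h0)
  have hq1 : q ≤ 1 := by linarith
  have hcap : ∀ {F : EuclideanSpace ℝ (Fin d) × ℝ → ℝ}, Measurable F → (∀ p, |F p| ≤ 1) →
      ∫ p, |F p| ∂P ≤ 1 := fun {F} hF hb => by
    have := integral_mono (μ := P) (Integrable.of_bound hF.abs.aestronglyMeasurable 1
      (ae_of_all _ fun p => by rw [Real.norm_eq_abs, abs_abs]; exact hb p))
      (integrable_const 1) hb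
    simpa using this
  -- the queries at the global scale
  have w0 : ∀ j, 0 ≤ coordWeight 0 i j := fun j => le_coordWeight 0 i j
  have w0i : 1 ≤ coordWeight 0 i i := by rw [coordWeight_self]; norm_num
  have bN : ∀ p, |observable Θ δ b i false false p| ≤ 1 := fun p =>
    (abs_scoreQuery_le b i w0 w0i p).trans
      (by linarith [abs_arctan_le_two (regResidual b δ p)])
  have bD : ∀ p, |observable Θ δ b i false true p| ≤ 1 := fun p =>
    (abs_slopeQuery_le b w0 p).trans (by linarith [abs_cauchyBump_le_one (regResidual b δ p)])
  -- For the global queries only the trivial bound `M = 1` on the mean is used.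
  have four : 2 * (q ^ 2 + √1 * q) ≤ 4 * q := by rw [Real.sqrt_one]; nlinarith
  have eN := (hmean false false 1 zero_le_one bN (hcap (measurable_observable ..) bN)).trans four
  have eD := (hmean false true 1 zero_le_one bD (hcap (measurable_observable ..) bD)).trans four
  have st : 2 * ∫ p, observable Θ δ b i false false p ∂P =
      (β i - b i) / δ * ∫ p, observable Θ δ b i false true p ∂P := by
    have := integral_scoreQuery_eq (δ := δ) b β i E (κ := 1) w0 w0i hasDerivAt_arctan_cauchyBump
      continuous_cauchyBump (fun u => (abs_arctan_le_two u).trans (by norm_num))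
      abs_cauchyBump_le_one (fun u => by
        rw [one_mul]; exact (abs_cauchyBump_le_one u).trans (by norm_num))
    rw [coordWeight_self] at this
    simp only [one_mul, mul_one, zero_add] at this
    rw [show (1 : ℝ) + 1 = 2 by norm_num] at this
    exact this
  have hmass := real_singleton_le_noiseMass (δ := δ) E
  have lD : noiseMass δ E / 18 ≤ ∫ p, observable Θ δ b i false true p ∂P := by
    refine le_trans ?_ (le_integral_slopeQuery_cauchyBump b β E w0 hγ)
    have := le_integral_gaussianWeight_coordWeight_zero i
    nlinarith
  rw [coordEstimate]
  split_ifs with hc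
  · exact abs_sigmoid_estimate_sub_le hα0 hq0 hq hΘ hγi st eN eD
      (le_trans (by linarith) lD) hc
  -- the queries at the local scale
  · rw [not_or, not_le, not_le] at hc
    obtain ⟨hΘ4, hsmall⟩ := hc
    have hΘ0 : 0 < Θ := by linarith
    have hαΘ : α ≤ Θ * α := by nlinarith
    -- The failed test bounds the true slope by `Θ α + 4 q ≤ 2 Θ α`, and the slope is at least
    -- `noiseMass δ E / 18`.
    have hPt : noiseMass δ E ≤ 36 * (Θ * α) := by
      have := (abs_le.1 eD).1
      linarith
    have hκ0 : 0 < scale Θ := by unfold scale; positivity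
    have hκ1 : scale Θ ≤ 1 := by
      rw [scale, div_le_one (by positivity)]; linarith
    have hκ2 : scale Θ ^ 2 ≤ 1 := by nlinarith
    have haκ : (1 + strength Θ) * scale Θ ^ 2 = 4 := by
      unfold strength; field_simp; ring
    have ha0 : 0 ≤ strength Θ := by
      rw [strength, sub_nonneg, le_div_iff₀ (by positivity)]; linarith
    have w0 : ∀ j, 0 ≤ coordWeight (strength Θ) i j := fun j => ha0.trans (le_coordWeight _ i j)
    have w0i : 1 ≤ coordWeight (strength Θ) i i := by rw [coordWeight_self]; linarith
    have bN' : ∀ p, |observable Θ δ b i true false p| ≤ cauchyBump (regResidual b δ p) := fun p =>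
      (abs_scoreQuery_le b i w0 w0i p).trans
        (by linarith [abs_localScore_le (scale Θ) (regResidual b δ p),
          cauchyBump_pos (regResidual b δ p)])
    have bD' : ∀ p, |observable Θ δ b i true true p| ≤ cauchyBump (regResidual b δ p) := fun p =>
      (abs_slopeQuery_le (h := fun u => scale Θ * localSlope (scale Θ) u) b w0 p).trans
        (by linarith [abs_mul_localSlope_le hκ0 hκ1 (regResidual b δ p)])
    have hM0 : 0 ≤ 4 * noiseMass δ E := by linarith
    have eN := hmean true false _ hM0 (fun p => (bN' p).trans (cauchyBump_le_one _))
      (integral_abs_le_of_le_cauchyBump b β E hγ (measurable_observable ..) bN')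
    have eD := hmean true true _ hM0 (fun p => (bD' p).trans (cauchyBump_le_one _))
      (integral_abs_le_of_le_cauchyBump b β E hγ (measurable_observable ..) bD')
    -- `4 · 36 = 12²`.
    have hη : 2 * (q ^ 2 + √(4 * noiseMass δ E) * q) ≤ 2 * (q ^ 2 + 12 * √(Θ * α) * q) := by
      have : √(4 * noiseMass δ E) ≤ 12 * √(Θ * α) := by
        rw [Real.sqrt_le_left (by positivity), mul_pow, Real.sq_sqrt (by positivity)]
        linarith
      gcongr
    have lD' := le_integral_slopeQuery_localSlope b β E ha0 (le_coordWeight (strength Θ) i) hγ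
      hκ0 hκ1 haκ.ge hE (by
        -- This equation determines the constant `1152 = 8 · 36 · 4` in `scale`.
        have e : 8 * scale Θ * (36 * (Θ * α)) = α / 4 := by
          unfold scale; field_simp; norm_num
        rw [← e]
        gcongr)
    have hW := le_integral_gaussianWeight_coordWeight i ha0 hκ0 (by linarith)
    have st : (2 + strength Θ) * scale Θ * ∫ p, observable Θ δ b i true false p ∂P =
        (β i - b i) / δ * ∫ p, observable Θ δ b i true true p ∂P := by
      have hb3 : ∀ u, |scale Θ * localSlope (scale Θ) u| ≤ 3 := fun u =>
        (abs_mul_localSlope_le hκ0 hκ1 u).trans (by linarith [cauchyBump_le_one u])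
      have := integral_scoreQuery_eq (δ := δ) b β i E (κ := scale Θ) w0 w0i
        (hasDerivAt_localScore (scale Θ)) (continuous_localSlope _)
        (fun u => (abs_localScore_le _ u).trans (by linarith [cauchyBump_le_one u]))
        (A := 3 / scale Θ) (fun u => by
          rw [le_div_iff₀ hκ0, mul_comm]
          have := hb3 u
          rwa [abs_mul, abs_of_pos hκ0] at this) hb3
      rw [coordWeight_self] at this
      rw [show 2 + strength Θ = 1 + (strength Θ + 1) by ring]
      exact this
    refine abs_local_estimate_sub_le d hα0 hq0 hq hα1.le hΘ4.le hΘα rfl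
      (by unfold strength; ring) rfl hγi st hη eN eD (le_trans ?_ lD')
    gcongr

theorem norm_sub_update_le {d m : ℕ} {Θ α δ q lam : ℝ} {b β : EuclideanSpace ℝ (Fin d)}
    {E : Measure ℝ} [IsProbabilityMeasure E] (hα : α ∈ Set.Ioo (0 : ℝ) 1) (hE : α ≤ E.real {0})
    (hΘ : 1 ≤ Θ) (hΘα : Θ ^ (4 * d + 12) * α = 1) (hδ : 0 < δ) (hb : ‖b - β‖ ≤ δ) (hq0 : 0 ≤ q)
    (hq : 10 ^ 7 * q ≤ α) (hm : 1 / (m : ℝ) ≤ q ^ 2)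
    (hqlam : √d * (10 ^ 7 * q / α / Θ) ≤ lam)
    {v : Fin d × Bool × Bool × Bool → ℝ}
    (hv : ∀ I, IsVSTATAnswer (obliviousRegression d β E) m (queries Θ δ b I) (v I)) :
    ‖update Θ α δ b v - β‖ ≤ lam * δ := by
  have hγ : ∑ j, ((β j - b j) / δ) ^ 2 ≤ 1 := by
    have h1 : ‖b - β‖ ^ 2 ≤ δ ^ 2 := by gcongr
    rw [EuclideanSpace.real_norm_sq_eq] at h1
    simp_rw [div_pow]
    rw [← Finset.sum_div, div_le_one (by positivity)]
    refine le_trans (le_of_eq ?_) h1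
    exact Finset.sum_congr rfl fun j _ => by simp; ring
  have hc := abs_coordEstimate_sub_le hα hE hΘ hΘα hγ hq0 hq hm hv
  set r := 10 ^ 7 * q / α / Θ
  have hr : 0 ≤ r := by have := hα.1; positivity
  have h2 : ‖update Θ α δ b v - β‖ ^ 2 ≤ (√d * r * δ) ^ 2 := by
    rw [EuclideanSpace.real_norm_sq_eq, mul_pow, mul_pow, Real.sq_sqrt (Nat.cast_nonneg d)]
    calc ∑ i, (update Θ α δ b v - β) i ^ 2 ≤ ∑ _i : Fin d, r ^ 2 * δ ^ 2 := by
          refine Finset.sum_le_sum fun i _ => ?_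
          have e : (update Θ α δ b v - β) i = (coordEstimate Θ α v i - (β i - b i) / δ) * δ := by
            simp only [update, PiLp.sub_apply, PiLp.add_apply, PiLp.smul_apply, smul_eq_mul]
            field_simp
            ring
          rw [e, mul_pow]
          refine mul_le_mul_of_nonneg_right ?_ (sq_nonneg δ)
          exact sq_le_sq' (abs_le.1 (hc i)).1 (abs_le.1 (hc i)).2
      _ = _ := by simp; ring
  have h3 := le_of_abs_le (abs_le_of_sq_le_sq h2 (by positivity))
  exact h3.trans (by gcongr)

/-- The contraction factor of a round. -/
noncomputable def contraction (d : ℕ) (α ε : ℝ) : ℝ := √ε / rate d α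

/-- The regression algorithm. -/
noncomputable def algorithm (d : ℕ) (α ε : ℝ) :
    SQAlgorithm (EuclideanSpace ℝ (Fin d) × ℝ) (EuclideanSpace ℝ (Fin d)) :=
  SQAlgorithm.rounds (fun t b => queries (rate d α) (contraction d α ε ^ t) b)
    (fun t b => update (rate d α) α (contraction d α ε ^ t) b) (4 * d + 12) 0 0

end ObliviousSQ

/-! ### Choice of parameters and conclusion -/

theorem mainTheorem6 :
    ∃ (p : Polynomial ℕ) (C₁ C₂ : ℝ) (k : ℕ)
      (A : (d : ℕ) → (α ε : ℝ) →
        SQAlgorithm (EuclideanSpace ℝ (Fin d) × ℝ) (EuclideanSpace ℝ (Fin d))),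
      0 < C₁ ∧ 0 < C₂ ∧
      ∀ (d : ℕ) (α ε : ℝ), 1 ≤ d → α ∈ Set.Ioo (0 : ℝ) 1 → ε ∈ Set.Ioo (0 : ℝ) 1 →
        (A d α ε).QueriesAtMost (p.eval d) ∧
        ∀ (βstar : EuclideanSpace ℝ (Fin d)), ‖βstar‖ ≤ 1 →
          ∀ (E : Measure ℝ) [IsProbabilityMeasure E], α ≤ E.real {0} →
            (A d α ε).Succeeds (obliviousRegression d βstar E)
              ⌈C₁ * d * Real.log (2 * d / α) ^ k / (ε * α ^ 2)⌉₊
              (fun βhat => ‖βhat - βstar‖ ≤ C₂ * ε * α) := by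
  -- Each of the `4 d + 12` rounds asks `8 d` queries: per coordinate, local or global, score or
  -- slope, and two signs. No logarithmic factor is needed, so `k = 0`.
  refine ⟨8 * Polynomial.X * (4 * Polynomial.X + 12), 10 ^ 14, 1, 0, ObliviousSQ.algorithm,
    by norm_num, one_pos, fun d α ε hd hα hε => ⟨?_, fun β hβ E _ hE => ?_⟩⟩
  · have := SQAlgorithm.queriesAtMost_rounds
      (fun t (b : EuclideanSpace ℝ (Fin d)) => ObliviousSQ.queries (ObliviousSQ.rate d α) (ObliviousSQ.contraction d α ε ^ t) b)
      (fun t (b : EuclideanSpace ℝ (Fin d)) => ObliviousSQ.update (ObliviousSQ.rate d α) α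
        (ObliviousSQ.contraction d α ε ^ t) b) (4 * d + 12) 0 0
    have e : Fintype.card (Fin d × Bool × Bool × Bool) * (4 * d + 12) =
        (8 * Polynomial.X * (4 * Polynomial.X + 12) : Polynomial ℕ).eval d := by
      simp; ring
    rw [← e]
    exact this
  obtain ⟨hε0, hε1⟩ := hε
  have hα0 := hα.1
  have hd0 : (0 : ℝ) < d := by exact_mod_cast hd
  have hd1 : (1 : ℝ) ≤ d := by exact_mod_cast hd
  have hΘ := ObliviousSQ.one_le_rate d hα
  have hΘα := ObliviousSQ.rate_pow_mul d hα
  have hΘ0 : 0 < ObliviousSQ.rate d α := by linarith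
  have hsε : 0 < √ε := Real.sqrt_pos.2 hε0
  have hsε1 : √ε ≤ 1 := Real.sqrt_le_one.2 hε1.le
  have hsd : 1 ≤ √(d : ℝ) := Real.one_le_sqrt.2 hd1
  have hlam : 0 < ObliviousSQ.contraction d α ε := div_pos hsε hΘ0
  -- Chosen so that `√d · 10 ^ 7 q / (α Θ)` equals the contraction factor `√ε / Θ`; then `q⁻² = 10 ^
  -- 14 d / (ε α²)` dictates `C₁`.
  set q : ℝ := α * √ε / (10 ^ 7 * √d)
  have hq0 : 0 ≤ q := by positivity
  have hq : 10 ^ 7 * q ≤ α := by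
    have e : 10 ^ 7 * q = α * √ε / √d := by simp only [q]; field_simp
    rw [e, div_le_iff₀ (by positivity)]
    gcongr
    linarith
  rw [pow_zero, mul_one]
  set m := ⌈10 ^ 14 * (d : ℝ) / (ε * α ^ 2)⌉₊
  have hm : 1 / (m : ℝ) ≤ q ^ 2 := by
    have h1 : 10 ^ 14 * (d : ℝ) / (ε * α ^ 2) ≤ m := Nat.le_ceil _
    have e : q ^ 2 = 1 / (10 ^ 14 * (d : ℝ) / (ε * α ^ 2)) := by
      simp only [q]
      rw [div_pow, mul_pow, mul_pow, Real.sq_sqrt hε0.le, Real.sq_sqrt hd0.le, one_div_div]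
      ring
    rw [e]
    exact one_div_le_one_div_of_le (by positivity) h1
  have hqlam : √d * (10 ^ 7 * q / α / ObliviousSQ.rate d α) ≤ ObliviousSQ.contraction d α ε := by
    refine le_of_eq ?_
    simp only [q, ObliviousSQ.contraction]
    field_simp
  have hrun := SQAlgorithm.succeeds_rounds (obliviousRegression d β E) m
    (fun t (b : EuclideanSpace ℝ (Fin d)) => ObliviousSQ.queries (ObliviousSQ.rate d α) (ObliviousSQ.contraction d α ε ^ t) b)
    (fun t (b : EuclideanSpace ℝ (Fin d)) => ObliviousSQ.update (ObliviousSQ.rate d α) α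
      (ObliviousSQ.contraction d α ε ^ t) b)
    (fun t (b : EuclideanSpace ℝ (Fin d)) => ‖b - β‖ ≤ ObliviousSQ.contraction d α ε ^ t)
    (fun t b v hb hv => by
      rw [pow_succ']
      exact ObliviousSQ.norm_sub_update_le hα hE hΘ hΘα (by positivity) hb hq0 hq hm
        hqlam hv)
    (4 * d + 12) 0 0 (by simpa using hβ)
  refine SQAlgorithm.Succeeds.mono (fun b hb => hb.trans ?_) hrun
  -- Over all rounds the powers of `Θ` multiply to exactly `1 / α`, while the powers of `√ε` give at
  -- most `ε`.
  rw [zero_add, ObliviousSQ.contraction, div_pow, div_le_iff₀ (by positivity), mul_assoc,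
    mul_comm α, hΘα, mul_one, one_mul]
  calc √ε ^ (4 * d + 12) ≤ √ε ^ 2 := pow_le_pow_of_le_one hsε.le hsε1 (by lia)
    _ = ε := Real.sq_sqrt hε0.le
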